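/- Let $r:\mathbb R\to\mathbb C$ be continuous with $|r(z)|<1$ for $z\neq 0$, $|r(0)|=1$ and $r(z)\to 0$ as $|z|\to\infty$. Fix $x,t\in\mathbb R$, put $\tau(z)=xz+4tz^3$, and let $$v_{x,t}(z)=\begin{pmatrix}1-|r(z)|^2 & -\overline{r(z)}\,e^{-2i\tau(z)}\\ r(z)\,e^{2i\tau(z)} & 1\end{pmatrix},\qquad z\in\mathbb R,$$ be the KdV jump matrix. Let $L^2(\mathbb R)$ denote the space of square-integrable $2\times2$ matrix-valued functions on $\mathbb R$. For $h\in L^2(\mathbb R)$ let $Ch(z)=\frac1{2\pi i}\int_{\mathbb R}\frac{h(s)}{s-z}\,ds$, $z\in\mathbb C\setminus\mathbb R$, and let $C^{+}h$ and $C^{-}h$ be the a.e. non-tangential limits of $Ch$ on $\mathbb R$ from the upper and the lower half-plane, respectively. For any a.e. factorization $v_{x,t}=(v^-)^{-1}v^+$ with $v^\pm,(v^\pm)^{-1}\in L^\infty(\mathbb R)$ put $\omega^+=v^+-I$, $\omega^-=I-v^-$ and $C_\omega h=C^+(h\omega^-)+C^-(h\omega^+)$. (1) For every such factorization the boundary values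 in the definition of $C_\omega h$ exist for all $h\in L^2(\mathbb R)$, $C_\omega$ is a bounded operator on $L^2(\mathbb R)$, and $1-C_\omega$ is Fredholm with index $0$ and trivial kernel; hence $1-C_\omega$ is a bijection of $L^2(\mathbb R)$. (2) If moreover $r\in L^2(\mathbb R)$, then the normalized Riemann–Hilbert problem $(\mathbb R,v_{x,t})$ in $L^2$ has exactly one solution up to equality almost everywhere: there is exactly one pair of functions $m_\pm$ on $\mathbb R$ such that $m_\pm=I+C^\pm h$ for some $h\in L^2(\mathbb R)$ and $m_+=m_-v_{x,t}$ a.e. on $\mathbb R$. -/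

import Mathlib

open MeasureTheory Filter Topology Complex
open scoped ENNReal Matrix ComplexConjugate

-- Matrices carry the Hilbert-Schmidt (Frobenius) norm.
attribute [local instance] Matrix.frobeniusNormedAddCommGroup Matrix.frobeniusNormedSpace

noncomputable section

namespace KdVRHP

/-- Complex `2 × 2` matrices. -/
abbrev M2 : Type := Matrix (Fin 2) (Fin 2) ℂ

/-- The Hilbert space `L²(ℝ)` of `2 × 2` matrix-valued functions. -/
abbrev L2M : Type := Lp M2 2 (volume : Measure ℝ)

/-- The jump matrix `v_{x,t}` on the real line, with `τ = x z + 4 t z³`. -/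
def kdvJump (r : ℝ → ℂ) (x t : ℝ) (z : ℝ) : M2 :=
  let τ : ℂ := ((x * z + 4 * t * z ^ 3 : ℝ) : ℂ)
  !![1 - ((‖r z‖ ^ 2 : ℝ) : ℂ), -(conj (r z)) * exp (-(2 * I * τ));
     r z * exp (2 * I * τ),     1]

section Cauchy

variable {E : Type*} [NormedAddCommGroup E] [NormedSpace ℂ E]

/-- The Cauchy operator `(C h)(z) = (1 / 2πi) ∫ h(s) / (s - z) ds` of the real line,
for `z` off the real line. -/
def cauchyIntegral (h : ℝ → E) (z : ℂ) : E :=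
  (2 * (Real.pi : ℂ) * I)⁻¹ • ∫ s : ℝ, ((s : ℂ) - z)⁻¹ • h s

/-- Non-tangential approach to `x` from above: within every vertical cone with vertex `x` in the
upper half-plane (of arbitrary opening angle less than `π`). -/
def ntAbove (x : ℝ) : Filter ℂ :=
  ⨆ a : {a : ℝ // 0 < a}, 𝓝[{z : ℂ | 0 < z.im ∧ |z.re - x| < a.1 * z.im}] (x : ℂ)

/-- Non-tangential approach to `x` from below. -/
def ntBelow (x : ℝ) : Filter ℂ :=
  ⨆ a : {a : ℝ // 0 < a}, 𝓝[{z : ℂ | z.im < 0 ∧ |z.re - x| < a.1 * (-z.im)}] (x : ℂ)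

/-- `g = C⁺ h`: the non-tangential limit of `C h` from above (the left of the oriented real line)
exists and equals `g x`, at almost every `x`. -/
def IsCauchyPlus (h g : ℝ → E) : Prop :=
  ∀ᵐ x : ℝ, Tendsto (cauchyIntegral h) (ntAbove x) (𝓝 (g x))

/-- `g = C⁻ h`: the non-tangential limit of `C h` from below exists and equals `g x`,
at almost every `x`. -/
def IsCauchyMinus (h g : ℝ → E) : Prop :=
  ∀ᵐ x : ℝ, Tendsto (cauchyIntegral h) (ntBelow x) (𝓝 (g x))

/-- The pair `(fp, fm)` of `L²` functions belongs to `∂C(L²)`: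
`fp = C⁺ h` and `fm = C⁻ h` for one `h ∈ L²`. -/
def MemBoundaryCauchy (fp fm : ℝ → E) : Prop :=
  MemLp fp 2 ∧ MemLp fm 2 ∧ ∃ h : ℝ → E, MemLp h 2 ∧ IsCauchyPlus h fp ∧ IsCauchyMinus h fm

/-- `f ∈ L^∞(ℝ)`. -/
def MemLinfty (f : ℝ → E) : Prop := MemLp f ∞

end Cauchy

/-- `v = (v⁻)⁻¹ v⁺` is a pointwise a.e. factorization with `v⁺, v⁻, (v⁺)⁻¹, (v⁻)⁻¹ ∈ L^∞`. -/
structure IsFactorization (v vm vp : ℝ → M2) : Prop where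
  memLp_minus : MemLinfty vm
  memLp_plus : MemLinfty vp
  isUnit_minus : ∀ᵐ z : ℝ, IsUnit (vm z)
  isUnit_plus : ∀ᵐ z : ℝ, IsUnit (vp z)
  memLp_inv_minus : MemLinfty (fun z => (vm z)⁻¹)
  memLp_inv_plus : MemLinfty (fun z => (vp z)⁻¹)
  eq_mul : ∀ᵐ z : ℝ, v z = (vm z)⁻¹ * vp z

/-- The bounded operator `T` on `L²` is `C_ω : h ↦ C⁺ (h ω⁻) + C⁻ (h ω⁺)`, for `ω = (ω⁻, ω⁺)`.
The boundary values determine `T` uniquely, see `IsBasicOperator.unique`. -/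
def IsBasicOperator (ωm ωp : ℝ → M2) (T : L2M →L[ℂ] L2M) : Prop :=
  ∀ h : L2M, ∃ gp gm : ℝ → M2,
    IsCauchyPlus (fun z => h z * ωm z) gp ∧ IsCauchyMinus (fun z => h z * ωp z) gm ∧
      ∀ᵐ z : ℝ, T h z = gp z + gm z

/-- The index `dim ker T - dim coker T` of a Fredholm operator. -/
def fredholmIndex {X Y : Type*} [NormedAddCommGroup X] [NormedSpace ℂ X]
    [NormedAddCommGroup Y] [NormedSpace ℂ Y] (T : X →L[ℂ] Y) : ℤ :=
  (Module.finrank ℂ T.ker : ℤ) - (Module.finrank ℂ (Y ⧸ T.range) : ℤ)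

/-- `(mp, mm)` solves the normalized Riemann-Hilbert problem `(ℝ, v)` in the sense of `L²`:
`m± ∈ I + ∂C(L²)` and `m₊ = m₋ v` almost everywhere. -/
def SolvesNormalizedRHP (v mp mm : ℝ → M2) : Prop :=
  MemBoundaryCauchy (fun z => mp z - 1) (fun z => mm z - 1) ∧ ∀ᵐ z : ℝ, mp z = mm z * v z

lemma ntAbove_neBot (x : ℝ) : (ntAbove x).NeBot := by
  have hle : 𝓝[{z : ℂ | 0 < z.im ∧ |z.re - x| < 1 * z.im}] (x : ℂ) ≤ ntAbove x :=
    le_iSup (fun a : {a : ℝ // 0 < a} =>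
      𝓝[{z : ℂ | 0 < z.im ∧ |z.re - x| < a.1 * z.im}] (x : ℂ)) ⟨1, one_pos⟩
  refine NeBot.mono ?_ hle
  have ht : Tendsto (fun e : ℝ => (x : ℂ) + e * I) (𝓝[>] (0 : ℝ))
      (𝓝[{z : ℂ | 0 < z.im ∧ |z.re - x| < 1 * z.im}] (x : ℂ)) := by
    refine tendsto_nhdsWithin_iff.2 ⟨?_, ?_⟩
    · have hc : Continuous fun e : ℝ => (x : ℂ) + e * I := by fun_prop
      simpa using (hc.tendsto 0).mono_left nhdsWithin_le_nhds
    · filter_upwards [self_mem_nhdsWithin] with e he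
      simpa using he
  exact ht.neBot

lemma ntBelow_neBot (x : ℝ) : (ntBelow x).NeBot := by
  have hle : 𝓝[{z : ℂ | z.im < 0 ∧ |z.re - x| < 1 * (-z.im)}] (x : ℂ) ≤ ntBelow x :=
    le_iSup (fun a : {a : ℝ // 0 < a} =>
      𝓝[{z : ℂ | z.im < 0 ∧ |z.re - x| < a.1 * (-z.im)}] (x : ℂ)) ⟨1, one_pos⟩
  refine NeBot.mono ?_ hle
  have ht : Tendsto (fun e : ℝ => (x : ℂ) + e * I) (𝓝[<] (0 : ℝ))
      (𝓝[{z : ℂ | z.im < 0 ∧ |z.re - x| < 1 * (-z.im)}] (x : ℂ)) := by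
    refine tendsto_nhdsWithin_iff.2 ⟨?_, ?_⟩
    · have hc : Continuous fun e : ℝ => (x : ℂ) + e * I := by fun_prop
      simpa using (hc.tendsto 0).mono_left nhdsWithin_le_nhds
    · filter_upwards [self_mem_nhdsWithin] with e he
      simpa using he
  exact ht.neBot

/-- At most one bounded operator is `C_ω`. -/
lemma IsBasicOperator.unique {ωm ωp : ℝ → M2} {T T' : L2M →L[ℂ] L2M}
    (hT : IsBasicOperator ωm ωp T) (hT' : IsBasicOperator ωm ωp T') : T = T' := by
  refine ContinuousLinearMap.ext fun h => Lp.ext ?_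
  obtain ⟨gp, gm, h1, h2, h3⟩ := hT h
  obtain ⟨gp', gm', h1', h2', h3'⟩ := hT' h
  filter_upwards [h1, h2, h3, h1', h2', h3'] with z a b c a' b' c'
  have := ntAbove_neBot z
  have := ntBelow_neBot z
  rw [c, c', tendsto_nhds_unique a a', tendsto_nhds_unique b b']

end KdVRHP

end

open KdVRHP

noncomputable section

namespace KdVRHP

/-! ### Cauchy and Poisson kernels of the real line. -/

section Kernel

/-! The space `L²` is the orthogonal sum of the Hardy spaces H₊ and H₋ of the two half-planes, with
projections P₊ = C⁺ (`hardyPlus`) and P₋ = -C⁻ (`hardyMinus`). H₋ is defined as the set of functions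
whose Cauchy integral vanishes in the upper half-plane, that is, as the orthogonal complement of the
kernels with poles below. The one fact needed beyond this is that kernels with poles above and below
are orthogonal; no density theorem enters. Boundary values follow because the jump of the Cauchy
integral between z and its conjugate is a Poisson integral, so Fatou's theorem applies to each Hardy
component.

With these projections 1 - C_ω = (P₊ + P₋v) ∘ v⁻, where v and v⁻ stand for right multiplication and
the second is invertible. The normalized problem is likewise equivalent to (P₊ + vP₋)h = v - 1. Both
operators are bijective as soon as the Toeplitz operator T = P₊ + P₋vP₋ is
(`IsAlmostCoercive.toeplitz_bijective`).

The Hermitian part of v is diag(1 - |r|², 1): positive definite away from z = 0, but degenerate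
there, so T is not coercive. The remedy is that near 0 the matrix v is close to the constant v(0),
of determinant 1, and right multiplication by a constant preserves H₋ and hence commutes with P₋
there. Far from 0 the deviation from v(0) is controlled by the real part of the form. Together these
bound T below (`IsAlmostCoercive.toeplitz_bounded_below`), so T is injective with closed range.
Anything orthogonal to the range annihilates the real part of the form, which is strictly positive
almost everywhere, and so vanishes. Bijectivity gives Fredholmness and index 0 at once. -/

lemma ofReal_sub_ne_zero {z : ℂ} (hz : z.im ≠ 0) (s : ℝ) : (s : ℂ) - z ≠ 0 := by
  intro h
  apply hz
  have := congrArg Complex.im h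
  simpa using this

lemma sq_norm_ofReal_sub (z : ℂ) (s : ℝ) : ‖(s : ℂ) - z‖ ^ 2 = (s - z.re) ^ 2 + z.im ^ 2 := by
  rw [Complex.sq_norm, Complex.normSq_apply]
  simp
  ring

lemma poisson_eq_scaled {y : ℝ} (hy : y ≠ 0) (u s : ℝ) :
    ((s - u) ^ 2 + y ^ 2)⁻¹ = (y ^ 2)⁻¹ * (1 + ((s - u) / y) ^ 2)⁻¹ := by
  rw [← mul_inv]
  congr 1
  field_simp
  ring

lemma integrable_poisson {y : ℝ} (hy : y ≠ 0) (u : ℝ) :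
    Integrable fun s : ℝ => ((s - u) ^ 2 + y ^ 2)⁻¹ := by
  simp_rw [poisson_eq_scaled hy]
  exact ((integrable_inv_one_add_sq.comp_div hy).comp_sub_right u).const_mul _

lemma integral_poisson {y : ℝ} (hy : y ≠ 0) (u : ℝ) :
    ∫ s : ℝ, ((s - u) ^ 2 + y ^ 2)⁻¹ = Real.pi / |y| := by
  simp_rw [poisson_eq_scaled hy]
  rw [integral_const_mul, integral_sub_right_eq_self (fun s : ℝ => (1 + (s / y) ^ 2)⁻¹) u,
    Measure.integral_comp_div (fun s : ℝ => (1 + s ^ 2)⁻¹) y, integral_univ_inv_one_add_sq,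
    smul_eq_mul, ← sq_abs y]
  have : |y| ≠ 0 := abs_ne_zero.2 hy
  field_simp

lemma continuous_cauchyKernel {z : ℂ} (hz : z.im ≠ 0) :
    Continuous fun s : ℝ => ((s : ℂ) - z)⁻¹ :=
  (by fun_prop : Continuous fun s : ℝ => (s : ℂ) - z).inv₀ (ofReal_sub_ne_zero hz)

lemma memLp_cauchyKernel {z : ℂ} (hz : z.im ≠ 0) :
    MemLp (fun s : ℝ => ((s : ℂ) - z)⁻¹) 2 := by
  rw [memLp_two_iff_integrable_sq_norm (continuous_cauchyKernel hz).aestronglyMeasurable]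
  simp_rw [norm_inv, inv_pow, sq_norm_ofReal_sub]
  exact integrable_poisson hz z.re

/-- With both poles on the same side, an explicit primitive vanishes at both ends of the line; this
replaces a contour argument. It is the source of the orthogonality of H₊ and H₋. -/
lemma integral_cauchyKernel_mul_of_im_pos {w z : ℂ} (hw : 0 < w.im) (hz : 0 < z.im) :
    ∫ s : ℝ, ((s : ℂ) - w)⁻¹ * ((s : ℂ) - z)⁻¹ = 0 := by
  have hint : Integrable fun s : ℝ => ((s : ℂ) - w)⁻¹ * ((s : ℂ) - z)⁻¹ :=
    (memLp_cauchyKernel hw.ne').integrable_mul (memLp_cauchyKernel hz.ne')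
  have hw0 := ofReal_sub_ne_zero hw.ne'
  have hz0 := ofReal_sub_ne_zero hz.ne'
  have hlim : ∀ z : ℂ, ∀ l : Filter ℝ, Tendsto (fun s : ℝ => ‖(s : ℂ)‖) l atTop →
      Tendsto (fun s : ℝ => ((s : ℂ) - z)⁻¹) l (𝓝 0) := by
    intro z l hl
    apply Tendsto.comp tendsto_inv₀_cobounded
    rw [← tendsto_norm_atTop_iff_cobounded]
    refine tendsto_atTop_mono (fun s => norm_sub_norm_le (s : ℂ) z) ?_
    exact tendsto_atTop_add_const_right _ _ hl
  have hbot : Tendsto (fun s : ℝ => ‖(s : ℂ)‖) atBot atTop := by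
    simpa using tendsto_abs_atBot_atTop
  have htop : Tendsto (fun s : ℝ => ‖(s : ℂ)‖) atTop atTop := by
    simpa using tendsto_abs_atTop_atTop
  have hofr : ∀ s : ℝ, HasDerivAt (fun s : ℝ => (s : ℂ)) 1 s := fun s => ofRealCLM.hasDerivAt
  by_cases hwz : w = z
  · subst hwz
    have hd : ∀ s : ℝ, HasDerivAt (fun s : ℝ => -((s : ℂ) - w)⁻¹)
        (((s : ℂ) - w)⁻¹ * ((s : ℂ) - w)⁻¹) s := by
      intro s
      have := (((hofr s).sub_const w).inv (hw0 s)).neg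
      refine this.congr_deriv ?_
      have := hw0 s
      field_simp
    have := integral_of_hasDerivAt_of_tendsto hd hint
      (hlim w _ hbot).neg (hlim w _ htop).neg
    simpa using this
  · have hwz' : w - z ≠ 0 := sub_ne_zero.2 hwz
    have hd : ∀ s : ℝ, HasDerivAt
        (fun s : ℝ => (log (w - s) - log (z - s)) * (w - z)⁻¹)
        (((s : ℂ) - w)⁻¹ * ((s : ℂ) - z)⁻¹) s := by
      intro s
      have h1 := ((hofr s).const_sub w).clog_real (Or.inr (by simpa using hw.ne'))
      have h2 := ((hofr s).const_sub z).clog_real (Or.inr (by simpa using hz.ne'))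
      refine ((h1.sub h2).mul_const _).congr_deriv ?_
      have a := hw0 s
      have b := hz0 s
      have a' : w - s ≠ 0 := by rw [← neg_sub]; exact neg_ne_zero.2 a
      have b' : z - s ≠ 0 := by rw [← neg_sub]; exact neg_ne_zero.2 b
      field_simp
      ring
    have hl : ∀ l : Filter ℝ, Tendsto (fun s : ℝ => ‖(s : ℂ)‖) l atTop →
        Tendsto (fun s : ℝ => (log (w - s) - log (z - s)) * (w - z)⁻¹) l (𝓝 0) := by
      intro l hl
      have h1 : Tendsto (fun s : ℝ => log (1 + (z - w) * ((s : ℂ) - z)⁻¹)) l (𝓝 0) := by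
        have : Tendsto (fun s : ℝ => 1 + (z - w) * ((s : ℂ) - z)⁻¹) l (𝓝 1) := by
          simpa using ((hlim z l hl).const_mul (z - w)).const_add 1
        simpa using this.clog (by simp)
      have h2 : ∀ s : ℝ, log (w - s) - log (z - s) = log (1 + (z - w) * ((s : ℂ) - z)⁻¹) := by
        intro s
        have b := hz0 s
        have b' : z - s ≠ 0 := by rw [← neg_sub]; exact neg_ne_zero.2 b
        have a' : w - s ≠ 0 := by rw [← neg_sub]; exact neg_ne_zero.2 (hw0 s)
        have e : 1 + (z - w) * ((s : ℂ) - z)⁻¹ = (w - s) / (z - s) := by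
          field_simp
          ring
        -- Both w - s and z - s lie in the upper half-plane, so the difference of their arguments
        -- stays in (-π, π] and the difference of principal logarithms is the logarithm of the
        -- quotient.
        have i1 : 0 ≤ arg (w - s) := arg_nonneg_iff.2 (by simpa using hw.le)
        have i2 : 0 ≤ arg (z - s) := arg_nonneg_iff.2 (by simpa using hz.le)
        have i3 : arg (z - s) < Real.pi := arg_lt_pi_iff.2 (Or.inr (by simpa using hz.ne'))
        have i4 := arg_le_pi (w - s)
        have hq : exp (log (w - s) - log (z - s)) = (w - s) / (z - s) := by
          rw [exp_sub, exp_log a', exp_log b']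
        rw [e, ← hq, log_exp]
        · rw [sub_im, log_im, log_im]
          linarith
        · rw [sub_im, log_im, log_im]
          linarith
      simpa [h2] using h1.mul_const ((w - z)⁻¹)
    have := integral_of_hasDerivAt_of_tendsto hd hint (hl _ hbot) (hl _ htop)
    simpa using this

end Kernel

/-! ### Lebesgue points and Poisson averages. -/

section LebesguePoint

variable {E : Type*} [NormedAddCommGroup E]

/-- The mean over `[x - ρ, x + ρ]` of the distance of `h` to the value `h x`. -/
def meanOsc (h : ℝ → E) (x ρ : ℝ) : ℝ≥0∞ :=
  (∫⁻ s in Metric.closedBall x ρ, ‖h s - h x‖ₑ) / volume (Metric.closedBall x ρ)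

lemma ae_tendsto_meanOsc {h : ℝ → E} (hh : LocallyIntegrable h) :
    ∀ᵐ x : ℝ, Tendsto (meanOsc h x) (𝓝[>] 0) (𝓝 0) := by
  filter_upwards [(Besicovitch.vitaliFamily (volume : Measure ℝ)).ae_tendsto_lintegral_enorm_sub_div
    hh] with x hx
  exact hx.comp (Besicovitch.tendsto_filterAt volume x)

/-- Small radii are handled by the limit at x. For radii at least δ, the inequality |h| ≤ |h|² + 1
bounds the mean by the `L²` mass divided by the length 2δ. The uniform bound serves as the
dominating constant in `tendsto_lintegral_poisson_sub`. -/
lemma exists_meanOsc_le {h : ℝ → E} (hh : MemLp h 2) {x : ℝ}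
    (hx : Tendsto (meanOsc h x) (𝓝[>] 0) (𝓝 0)) :
    ∃ B : ℝ≥0∞, B ≠ ∞ ∧ ∀ ρ : ℝ, 0 < ρ → meanOsc h x ρ ≤ B := by
  obtain ⟨δ, hδ, hδ'⟩ : ∃ δ : ℝ, 0 < δ ∧ ∀ ρ ∈ Set.Ioo 0 δ, meanOsc h x ρ ≤ 1 := by
    have := hx.eventually (eventually_le_nhds (zero_lt_one (α := ℝ≥0∞)))
    obtain ⟨δ, hδ, hs⟩ := mem_nhdsGT_iff_exists_Ioo_subset.1 this
    exact ⟨δ, hδ, fun ρ hρ => hs hρ⟩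
  set N : ℝ≥0∞ := ∫⁻ s : ℝ, ‖h s‖ₑ ^ 2
  have hN : N ≠ ∞ := by
    have := (lintegral_rpow_enorm_lt_top_of_eLpNorm_lt_top (by norm_num) (by norm_num) hh.2).ne
    simpa using this
  set V : ℝ≥0∞ := ENNReal.ofReal (2 * δ)
  have hV : V ≠ 0 := by simpa [V] using hδ
  refine ⟨1 + (1 + N / V + ‖h x‖ₑ), ?_, fun ρ hρ => ?_⟩
  · finiteness
  rcases lt_or_ge ρ δ with hlt | hge
  · exact (hδ' ρ ⟨hρ, hlt⟩).trans le_self_add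
  refine le_trans ?_ le_add_self
  have hvol : volume (Metric.closedBall x ρ) = ENNReal.ofReal (2 * ρ) := Real.volume_closedBall x ρ
  have hV0 : volume (Metric.closedBall x ρ) ≠ 0 := by simpa [hvol] using hρ
  have hVt : volume (Metric.closedBall x ρ) ≠ ∞ := by
    rw [hvol]
    exact ENNReal.ofReal_ne_top
  have hle : V ≤ volume (Metric.closedBall x ρ) := by
    rw [hvol]
    exact ENNReal.ofReal_le_ofReal (by linarith)
  have hpt : ∀ s, ‖h s - h x‖ₑ ≤ ‖h s‖ₑ ^ 2 + (1 + ‖h x‖ₑ) := by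
    intro s
    refine enorm_sub_le.trans ?_
    rw [← add_assoc]
    gcongr
    rcases le_total ‖h s‖ₑ 1 with h1 | h1
    · exact h1.trans le_add_self
    · refine le_trans ?_ le_self_add
      simpa [sq] using mul_le_mul_left h1 ‖h s‖ₑ
  have hint : ∫⁻ s in Metric.closedBall x ρ, ‖h s - h x‖ₑ ≤
      N + (1 + ‖h x‖ₑ) * volume (Metric.closedBall x ρ) := by
    refine (lintegral_mono hpt).trans ?_
    rw [lintegral_add_right _ measurable_const, setLIntegral_const]
    gcongr
    exact setLIntegral_le_lintegral _ _
  unfold meanOsc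
  calc _ ≤ (N + (1 + ‖h x‖ₑ) * volume (Metric.closedBall x ρ)) /
        volume (Metric.closedBall x ρ) := by gcongr
    _ = N / volume (Metric.closedBall x ρ) + (1 + ‖h x‖ₑ) := by
        rw [ENNReal.add_div, ENNReal.mul_div_cancel_right hV0 hVt]
    _ ≤ N / V + (1 + ‖h x‖ₑ) := by gcongr
    _ = _ := by ring

/-- Take the least k with |d| ≤ 2^k y: if k > 0 then |d| > 2^(k-1) y, which produces the decay
4^(-k). -/
lemma exists_poisson_le_dyadic {y : ℝ} (hy : 0 < y) (d : ℝ) :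
    ∃ k : ℕ, |d| ≤ 2 ^ k * y ∧ y * (d ^ 2 + y ^ 2)⁻¹ ≤ 4 * (1 / 4) ^ k * y⁻¹ := by
  have hex : ∃ k : ℕ, |d| ≤ 2 ^ k * y := by
    obtain ⟨k, hk⟩ := pow_unbounded_of_one_lt (|d| / y) (one_lt_two (α := ℝ))
    exact ⟨k, ((div_lt_iff₀ hy).1 hk).le⟩
  classical
  refine ⟨Nat.find hex, Nat.find_spec hex, ?_⟩
  have hpos : 0 < d ^ 2 + y ^ 2 := by positivity
  rw [← div_eq_mul_inv, ← div_eq_mul_inv, div_le_div_iff₀ hpos hy]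
  rcases Nat.eq_zero_or_pos (Nat.find hex) with h0 | h0
  · rw [h0]
    nlinarith [sq_nonneg d, sq_nonneg y]
  · obtain ⟨j, hj⟩ := Nat.exists_eq_succ_of_ne_zero h0.ne'
    have hlt : 2 ^ j * y < |d| := not_le.1 (Nat.find_min hex (m := j) (by omega))
    rw [hj]
    have h2 : (2 ^ j * y) ^ 2 ≤ d ^ 2 := by
      rw [← sq_abs d]
      exact pow_le_pow_left₀ (by positivity) hlt.le 2
    have h4 : (2 ^ j * y) ^ 2 = 4 ^ j * y ^ 2 := by
      rw [mul_pow, ← pow_mul, mul_comm j 2, pow_mul]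
      norm_num
    have h5 : (1 / 4 : ℝ) ^ j * (4 ^ j * y ^ 2) = y ^ 2 := by
      rw [← mul_assoc, ← mul_pow]
      norm_num
    have h6 : (1 / 4 : ℝ) ^ j * (4 ^ j * y ^ 2) ≤ (1 / 4 : ℝ) ^ j * d ^ 2 := by
      rw [← h4]
      gcongr
    have h7 : 0 ≤ (1 / 4 : ℝ) ^ j * y ^ 2 := by positivity
    simp only [Nat.succ_eq_add_one, pow_succ]
    nlinarith

/-- Dyadic balls of length 2 · 2^k y carry kernel height 4 · 4^(-k) / y; the product is the summable
weight 8 · 2^(-k). -/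
lemma lintegral_poisson_sub_le {h : ℝ → E} (hh : AEStronglyMeasurable h) {x y : ℝ} (hy : 0 < y) :
    ∫⁻ s : ℝ, ENNReal.ofReal (y * ((s - x) ^ 2 + y ^ 2)⁻¹) * ‖h s - h x‖ₑ ≤
      ∑' k : ℕ, ENNReal.ofReal (8 * (1 / 2) ^ k) * meanOsc h x (2 ^ k * y) := by
  have hm : AEMeasurable (fun s => ‖h s - h x‖ₑ) := (hh.sub aestronglyMeasurable_const).enorm
  calc _ ≤ ∫⁻ s : ℝ, ∑' k : ℕ, ENNReal.ofReal (4 * (1 / 4) ^ k * y⁻¹) *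
        (Metric.closedBall x (2 ^ k * y)).indicator (fun s => ‖h s - h x‖ₑ) s := by
        refine lintegral_mono fun s => ?_
        obtain ⟨k, hk, hk'⟩ := exists_poisson_le_dyadic hy (s - x)
        refine le_trans ?_ (ENNReal.le_tsum k)
        rw [Set.indicator_of_mem (by simpa [Real.dist_eq] using hk)]
        gcongr
    _ = ∑' k : ℕ, ENNReal.ofReal (4 * (1 / 4) ^ k * y⁻¹) *
        ∫⁻ s in Metric.closedBall x (2 ^ k * y), ‖h s - h x‖ₑ := by
        rw [lintegral_tsum fun k =>
          (hm.indicator Metric.isClosed_closedBall.measurableSet).const_mul _]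
        refine tsum_congr fun k => ?_
        rw [lintegral_const_mul'' _ (hm.indicator Metric.isClosed_closedBall.measurableSet),
          lintegral_indicator Metric.isClosed_closedBall.measurableSet]
    _ = _ := by
        refine tsum_congr fun k => ?_
        have hV : volume (Metric.closedBall x (2 ^ k * y)) = ENNReal.ofReal (2 * (2 ^ k * y)) :=
          Real.volume_closedBall _ _
        have hpos : 0 < 2 * (2 ^ k * y) := by positivity
        rw [meanOsc, hV, ENNReal.div_eq_inv_mul, ← mul_assoc, ← ENNReal.ofReal_inv_of_pos hpos,
          ← ENNReal.ofReal_mul (by positivity)]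
        congr 2
        have : (1 / 4 : ℝ) ^ k = (1 / 2) ^ k * (1 / 2) ^ k := by rw [← mul_pow]; norm_num
        rw [this]
        have h2 : (1 / 2 : ℝ) ^ k * 2 ^ k = 1 := by rw [← mul_pow]; norm_num
        field_simp
        rw [one_div, inv_pow]
        field_simp
        norm_num

lemma tendsto_lintegral_poisson_sub {h : ℝ → E} (hh : MemLp h 2) {x : ℝ}
    (hx : Tendsto (meanOsc h x) (𝓝[>] 0) (𝓝 0)) :
    Tendsto (fun y : ℝ => ∫⁻ s : ℝ, ENNReal.ofReal (y * ((s - x) ^ 2 + y ^ 2)⁻¹) * ‖h s - h x‖ₑ)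
      (𝓝[>] 0) (𝓝 0) := by
  obtain ⟨B, hB, hB'⟩ := exists_meanOsc_le hh hx
  -- The dyadic sum is an integral over counting measure, so dominated convergence passes to the
  -- limit term by term.
  have key : Tendsto (fun y : ℝ => ∫⁻ k : ℕ, ENNReal.ofReal (8 * (1 / 2) ^ k) *
      meanOsc h x (2 ^ k * y) ∂Measure.count) (𝓝[>] 0) (𝓝 (∫⁻ _ : ℕ, 0 ∂Measure.count)) := by
    refine tendsto_lintegral_filter_of_dominated_convergence
      (fun k => ENNReal.ofReal (8 * (1 / 2) ^ k) * B) (Eventually.of_forall fun y => by fun_prop)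
      ?_ ?_ ?_
    · filter_upwards [self_mem_nhdsWithin] with y hy
      refine Eventually.of_forall fun k => ?_
      gcongr
      exact hB' _ (by have : 0 < y := hy; positivity)
    · rw [lintegral_count, ENNReal.tsum_mul_right, ← ENNReal.ofReal_tsum_of_nonneg]
      · finiteness
      · intro k; positivity
      · exact summable_geometric_two.mul_left 8
    · refine Eventually.of_forall fun k => ?_
      have h1 : Tendsto (fun y : ℝ => 2 ^ k * y) (𝓝[>] 0) (𝓝[>] 0) := by
        refine tendsto_nhdsWithin_iff.2 ⟨?_, ?_⟩
        · have : Continuous fun y : ℝ => 2 ^ k * y := by fun_prop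
          simpa using (this.tendsto 0).mono_left nhdsWithin_le_nhds
        · filter_upwards [self_mem_nhdsWithin] with y hy
          have : 0 < y := hy
          exact mul_pos (by positivity) this
      have h2 := ENNReal.Tendsto.const_mul (a := ENNReal.ofReal (8 * (1 / 2) ^ k)) (hx.comp h1)
        (Or.inr ENNReal.ofReal_ne_top)
      rwa [mul_zero] at h2
  rw [lintegral_zero] at key
  refine tendsto_of_tendsto_of_tendsto_of_le_of_le' tendsto_const_nhds key
    (Eventually.of_forall fun _ => zero_le) ?_
  filter_upwards [self_mem_nhdsWithin] with y hy
  rw [lintegral_count]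
  exact lintegral_poisson_sub_le hh.1 hy

lemma ae_isLebesguePoint {h : ℝ → E} (hh : MemLp h 2) :
    ∀ᵐ x : ℝ, Tendsto (meanOsc h x) (𝓝[>] 0) (𝓝 0) :=
  ae_tendsto_meanOsc (hh.locallyIntegrable (by norm_num))

end LebesguePoint

/-! ### Nontangential boundary values of Cauchy integrals. -/

section NontangentialLimits

variable {E : Type*} [NormedAddCommGroup E] [NormedSpace ℂ E]

lemma integrable_cauchyKernel_smul {h : ℝ → E} (hh : MemLp h 2) {z : ℂ} (hz : z.im ≠ 0) :
    Integrable fun s : ℝ => ((s : ℂ) - z)⁻¹ • h s :=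
  memLp_one_iff_integrable.1 (hh.smul (memLp_cauchyKernel hz))

lemma memLp_cauchyKernel_smul_const {w : ℂ} (hw : w.im ≠ 0) (e : E) :
    MemLp (fun s : ℝ => ((s : ℂ) - w)⁻¹ • e) 2 :=
  ((1 : ℂ →L[ℂ] ℂ).smulRight e).comp_memLp' (memLp_cauchyKernel hw)

lemma cauchyIntegral_congr {h g : ℝ → E} (hg : h =ᵐ[volume] g) :
    cauchyIntegral h = cauchyIntegral g := by
  funext z
  unfold cauchyIntegral
  congr 1
  refine integral_congr_ae ?_
  filter_upwards [hg] with s hs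
  rw [hs]

lemma cauchyKernel_sub_conj {z : ℂ} (hz : z.im ≠ 0) (s : ℝ) :
    ((s : ℂ) - z)⁻¹ - ((s : ℂ) - conj z)⁻¹ =
      2 * I * z.im * (((s - z.re) ^ 2 + z.im ^ 2)⁻¹ : ℝ) := by
  have h1 := ofReal_sub_ne_zero hz s
  have h2 : (s : ℂ) - conj z ≠ 0 := ofReal_sub_ne_zero (by simpa using hz) s
  have h3 : (((s - z.re) ^ 2 + z.im ^ 2 : ℝ) : ℂ) = (s - z) * (s - conj z) := by
    have : (s : ℂ) - conj z = conj ((s : ℂ) - z) := by simp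
    rw [this, mul_conj, ← sq_norm_ofReal_sub, normSq_eq_norm_sq]
  have h4 : z - conj z = 2 * I * z.im := by
    rw [sub_conj]
    push_cast
    ring
  rw [ofReal_inv, h3, ← h4]
  field_simp
  ring

lemma integrable_poisson_smul {h : ℝ → E} (hh : MemLp h 2) {z : ℂ} (hz : z.im ≠ 0) :
    Integrable fun s : ℝ => (((s - z.re) ^ 2 + z.im ^ 2)⁻¹ : ℝ) • h s := by
  have h1 := ((integrable_cauchyKernel_smul hh hz).sub
    (integrable_cauchyKernel_smul hh (z := conj z) (by simpa using hz))).smul (2 * I * z.im)⁻¹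
  refine h1.congr (Eventually.of_forall fun s => ?_)
  have hc : (2 * I * z.im : ℂ) ≠ 0 := by simpa using hz
  change (2 * I * z.im : ℂ)⁻¹ • (((s : ℂ) - z)⁻¹ • h s - ((s : ℂ) - conj z)⁻¹ • h s) = _
  rw [← sub_smul, cauchyKernel_sub_conj hz, smul_smul, ← mul_assoc, inv_mul_cancel₀ hc, one_mul,
    Complex.coe_smul]

/-- The jump of the Cauchy integral across the real line is a Poisson integral. -/
lemma cauchyIntegral_sub_conj {h : ℝ → E} (hh : MemLp h 2) {z : ℂ} (hz : z.im ≠ 0) :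
    cauchyIntegral h z - cauchyIntegral h (conj z) =
      (z.im / Real.pi) • ∫ s : ℝ, (((s - z.re) ^ 2 + z.im ^ 2)⁻¹ : ℝ) • h s := by
  unfold cauchyIntegral
  rw [← smul_sub, ← integral_sub (integrable_cauchyKernel_smul hh hz)
    (integrable_cauchyKernel_smul hh (z := conj z) (by simpa using hz))]
  have hk : ∀ s : ℝ, ((s : ℂ) - z)⁻¹ • h s - ((s : ℂ) - conj z)⁻¹ • h s =
      (2 * I * z.im : ℂ) • ((((s - z.re) ^ 2 + z.im ^ 2)⁻¹ : ℝ) • h s) := fun s => by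
    rw [← sub_smul, cauchyKernel_sub_conj hz, mul_smul _ (_ : ℂ), Complex.coe_smul]
  simp_rw [hk]
  rw [integral_smul, smul_smul, ← Complex.coe_smul (z.im / Real.pi)]
  congr 1
  have : (Real.pi : ℂ) ≠ 0 := by simp [Real.pi_ne_zero]
  push_cast
  field_simp

/-- Subtracting h x is free because the Poisson kernel has mass 1. Inside a cone of aperture a, the
kernel centred at z.re is at most 2a² + 2 times the one centred at x, so the vertical estimate
suffices. -/
lemma enorm_poisson_sub_le [CompleteSpace E] {h : ℝ → E} (hh : MemLp h 2) {a x : ℝ} {z : ℂ}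
    (hz : z.im ≠ 0) (hza : |z.re - x| < a * |z.im|) :
    ‖((|z.im| / Real.pi) • ∫ s : ℝ, (((s - z.re) ^ 2 + z.im ^ 2)⁻¹ : ℝ) • h s) - h x‖ₑ ≤
      ENNReal.ofReal ((2 * a ^ 2 + 2) / Real.pi) *
        ∫⁻ s : ℝ, ENNReal.ofReal (|z.im| * ((s - x) ^ 2 + |z.im| ^ 2)⁻¹) * ‖h s - h x‖ₑ := by
  have hpi := Real.pi_pos
  have hy : 0 < |z.im| := abs_pos.2 hz
  have h1 : h x = (|z.im| / Real.pi) •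
      ∫ s : ℝ, (((s - z.re) ^ 2 + z.im ^ 2)⁻¹ : ℝ) • h x := by
    rw [integral_smul_const, integral_poisson hz, smul_smul, div_mul_div_cancel₀ hpi.ne',
      div_self hy.ne', one_smul]
  have h2 : ((|z.im| / Real.pi) • ∫ s : ℝ, (((s - z.re) ^ 2 + z.im ^ 2)⁻¹ : ℝ) • h s) - h x =
      ∫ s : ℝ, (|z.im| / Real.pi * ((s - z.re) ^ 2 + z.im ^ 2)⁻¹) • (h s - h x) := by
    conv_lhs => rw [h1]
    rw [← smul_sub, ← integral_sub (integrable_poisson_smul hh hz)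
      ((integrable_poisson hz _).smul_const _), ← integral_smul]
    simp_rw [← smul_sub, smul_smul]
  rw [h2]
  refine (enorm_integral_le_lintegral_enorm _).trans ?_
  rw [← lintegral_const_mul' _ _ ENNReal.ofReal_ne_top]
  refine lintegral_mono fun s => ?_
  rw [enorm_smul, ← mul_assoc, ← ENNReal.ofReal_mul (by positivity),
    Real.enorm_of_nonneg (by positivity)]
  gcongr ENNReal.ofReal ?_ * _
  have hsq : (z.re - x) ^ 2 ≤ a ^ 2 * z.im ^ 2 := by
    rw [← sq_abs (z.re - x), ← sq_abs z.im, ← mul_pow]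
    exact pow_le_pow_left₀ (abs_nonneg _) hza.le 2
  have hp : 0 < (s - z.re) ^ 2 + z.im ^ 2 := by positivity
  have hp' : 0 < (s - x) ^ 2 + z.im ^ 2 := by positivity
  have hle : (s - x) ^ 2 + z.im ^ 2 ≤ (2 * a ^ 2 + 2) * ((s - z.re) ^ 2 + z.im ^ 2) := by
    nlinarith [sq_nonneg (s - z.re - (z.re - x)), sq_nonneg (a * (s - z.re)), sq_nonneg (a * z.im),
      sq_nonneg z.im, sq_nonneg (s - z.re)]
  rw [sq_abs]
  have : ((s - z.re) ^ 2 + z.im ^ 2)⁻¹ ≤ (2 * a ^ 2 + 2) * ((s - x) ^ 2 + z.im ^ 2)⁻¹ := by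
    rw [← div_eq_mul_inv, inv_eq_one_div, div_le_div_iff₀ hp hp']
    linarith
  calc _ ≤ |z.im| / Real.pi * ((2 * a ^ 2 + 2) * ((s - x) ^ 2 + z.im ^ 2)⁻¹) := by gcongr
    _ = _ := by ring

/-- Fatou's theorem for Poisson integrals of `L²` functions. -/
lemma tendsto_poisson [CompleteSpace E] {h : ℝ → E} (hh : MemLp h 2) {x : ℝ}
    (hx : Tendsto (meanOsc h x) (𝓝[>] 0) (𝓝 0)) (a : ℝ) :
    Tendsto (fun z : ℂ => (|z.im| / Real.pi) •
        ∫ s : ℝ, (((s - z.re) ^ 2 + z.im ^ 2)⁻¹ : ℝ) • h s)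
      (𝓝[{z : ℂ | z.im ≠ 0 ∧ |z.re - x| < a * |z.im|}] (x : ℂ)) (𝓝 (h x)) := by
  rw [tendsto_iff_edist_tendsto_0]
  have him : Tendsto (fun z : ℂ => |z.im|)
      (𝓝[{z : ℂ | z.im ≠ 0 ∧ |z.re - x| < a * |z.im|}] (x : ℂ)) (𝓝[>] 0) := by
    refine tendsto_nhdsWithin_iff.2 ⟨?_, ?_⟩
    · have : Continuous fun z : ℂ => |z.im| := by fun_prop
      simpa using (this.tendsto (x : ℂ)).mono_left nhdsWithin_le_nhds
    · filter_upwards [self_mem_nhdsWithin] with z hz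
      exact abs_pos.2 hz.1
  have key := ENNReal.Tendsto.const_mul (a := ENNReal.ofReal ((2 * a ^ 2 + 2) / Real.pi))
    ((tendsto_lintegral_poisson_sub hh hx).comp him) (Or.inr ENNReal.ofReal_ne_top)
  rw [mul_zero] at key
  refine tendsto_of_tendsto_of_tendsto_of_le_of_le' tendsto_const_nhds key
    (Eventually.of_forall fun _ => zero_le) ?_
  filter_upwards [self_mem_nhdsWithin] with z hz
  rw [edist_eq_enorm_sub]
  exact enorm_poisson_sub_le hh hz.1 hz.2

/-- If the Cauchy integral of `h` vanishes in the lower half-plane, then `C⁺ h = h`. -/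
lemma isCauchyPlus_self [CompleteSpace E] {h : ℝ → E} (hh : MemLp h 2)
    (h0 : ∀ z : ℂ, z.im < 0 → cauchyIntegral h z = 0) : IsCauchyPlus h h := by
  filter_upwards [ae_isLebesguePoint hh] with x hx
  refine tendsto_iSup.2 fun a => ?_
  refine Tendsto.congr' ?_ ((tendsto_poisson hh hx a.1).mono_left (nhdsWithin_mono _ ?_))
  · filter_upwards [self_mem_nhdsWithin] with z hz
    rw [abs_of_pos hz.1, ← cauchyIntegral_sub_conj hh hz.1.ne', h0 (conj z) (by simpa using hz.1),
      sub_zero]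
  · rintro z ⟨h1, h2⟩
    exact ⟨h1.ne', by rwa [abs_of_pos h1]⟩

/-- If the Cauchy integral of `h` vanishes in the upper half-plane, then `C⁻ h = -h`. -/
lemma isCauchyMinus_neg_self [CompleteSpace E] {h : ℝ → E} (hh : MemLp h 2)
    (h0 : ∀ z : ℂ, 0 < z.im → cauchyIntegral h z = 0) : IsCauchyMinus h (fun x => -h x) := by
  filter_upwards [ae_isLebesguePoint hh] with x hx
  refine tendsto_iSup.2 fun a => ?_
  refine Tendsto.congr' ?_ ((tendsto_poisson hh hx a.1).mono_left (nhdsWithin_mono _ ?_)).neg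
  · filter_upwards [self_mem_nhdsWithin] with z hz
    rw [abs_of_neg hz.1, neg_div, neg_smul, neg_neg, ← cauchyIntegral_sub_conj hh hz.1.ne,
      h0 (conj z) (by simpa using hz.1), sub_zero]
  · rintro z ⟨h1, h2⟩
    exact ⟨h1.ne, by rwa [abs_of_neg h1]⟩

/-- If the Cauchy integral of `h` vanishes in the lower half-plane, then `C⁻ h = 0`. -/
lemma isCauchyMinus_zero {h : ℝ → E} (h0 : ∀ z : ℂ, z.im < 0 → cauchyIntegral h z = 0) :
    IsCauchyMinus h 0 := by
  refine Eventually.of_forall fun x => tendsto_iSup.2 fun a => ?_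
  refine tendsto_const_nhds.congr' ?_
  filter_upwards [self_mem_nhdsWithin] with z hz
  exact (h0 z hz.1).symm

/-- If the Cauchy integral of `h` vanishes in the upper half-plane, then `C⁺ h = 0`. -/
lemma isCauchyPlus_zero {h : ℝ → E} (h0 : ∀ z : ℂ, 0 < z.im → cauchyIntegral h z = 0) :
    IsCauchyPlus h 0 := by
  refine Eventually.of_forall fun x => tendsto_iSup.2 fun a => ?_
  refine tendsto_const_nhds.congr' ?_
  filter_upwards [self_mem_nhdsWithin] with z hz
  exact (h0 z hz.1).symm

lemma cauchyIntegral_add {h g : ℝ → E} (hh : MemLp h 2) (hg : MemLp g 2) {z : ℂ}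
    (hz : z.im ≠ 0) :
    cauchyIntegral (h + g) z = cauchyIntegral h z + cauchyIntegral g z := by
  unfold cauchyIntegral
  rw [← smul_add, ← integral_add (integrable_cauchyKernel_smul hh hz)
    (integrable_cauchyKernel_smul hg hz)]
  simp

lemma IsCauchyPlus.add {h g f k : ℝ → E} (hh : MemLp h 2) (hg : MemLp g 2)
    (hf : IsCauchyPlus h f) (hk : IsCauchyPlus g k) : IsCauchyPlus (h + g) (f + k) := by
  filter_upwards [hf, hk] with x h1 h2
  refine (h1.add h2).congr' ?_
  refine eventually_iSup.2 fun a => ?_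
  filter_upwards [self_mem_nhdsWithin] with z hz
  exact (cauchyIntegral_add hh hg hz.1.ne').symm

lemma IsCauchyMinus.add {h g f k : ℝ → E} (hh : MemLp h 2) (hg : MemLp g 2)
    (hf : IsCauchyMinus h f) (hk : IsCauchyMinus g k) : IsCauchyMinus (h + g) (f + k) := by
  filter_upwards [hf, hk] with x h1 h2
  refine (h1.add h2).congr' ?_
  refine eventually_iSup.2 fun a => ?_
  filter_upwards [self_mem_nhdsWithin] with z hz
  exact (cauchyIntegral_add hh hg hz.1.ne).symm

lemma IsCauchyPlus.ae_eq {h f k : ℝ → E} (hf : IsCauchyPlus h f) (hk : IsCauchyPlus h k) :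
    f =ᵐ[volume] k := by
  filter_upwards [hf, hk] with x h1 h2
  have := ntAbove_neBot x
  exact tendsto_nhds_unique h1 h2

lemma IsCauchyMinus.ae_eq {h f k : ℝ → E} (hf : IsCauchyMinus h f) (hk : IsCauchyMinus h k) :
    f =ᵐ[volume] k := by
  filter_upwards [hf, hk] with x h1 h2
  have := ntBelow_neBot x
  exact tendsto_nhds_unique h1 h2

end NontangentialLimits

/-! ### Hardy spaces as orthogonal complements, and the projections onto them. -/

section Hardy

variable {E : Type*} [NormedAddCommGroup E] [InnerProductSpace ℂ E] [CompleteSpace E]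

variable (E) in
/-- The span of the Cauchy kernels with poles in the lower half-plane. -/
def lowerKernelSpan : Submodule ℂ (Lp E 2 (volume : Measure ℝ)) :=
  Submodule.span ℂ {f | ∃ (w : ℂ) (hw : w.im < 0) (e : E),
    f = (memLp_cauchyKernel_smul_const hw.ne e).toLp}

lemma inner_cauchyKernel {w : ℂ} (hw : w.im ≠ 0) (e : E) (h : Lp E 2 (volume : Measure ℝ)) :
    inner ℂ (memLp_cauchyKernel_smul_const hw e).toLp h =
      inner ℂ e (∫ s : ℝ, ((s : ℂ) - conj w)⁻¹ • h s) := by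
  rw [L2.inner_def, ← integral_inner
    (integrable_cauchyKernel_smul (Lp.memLp h) (by simpa using hw))]
  refine integral_congr_ae ?_
  filter_upwards [(memLp_cauchyKernel_smul_const hw e).coeFn_toLp] with s hs
  rw [hs, inner_smul_left, inner_smul_right]
  simp

/-- Pairing h with the kernel of pole w evaluates its Cauchy integral at the conjugate of w, up to a
nonzero constant. -/
lemma mem_lowerKernelSpan_orthogonal_iff {h : Lp E 2 (volume : Measure ℝ)} :
    h ∈ (lowerKernelSpan E)ᗮ ↔ ∀ z : ℂ, 0 < z.im → cauchyIntegral h z = 0 := by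
  have hc : (2 * (Real.pi : ℂ) * I)⁻¹ ≠ 0 := by simp [Real.pi_ne_zero]
  simp only [cauchyIntegral, smul_eq_zero, hc, false_or]
  constructor
  · intro hh z hz
    have hw : (conj z).im < 0 := by simpa using hz
    have := fun e : E => (inner_cauchyKernel hw.ne e h).symm.trans
      (hh _ (Submodule.subset_span ⟨conj z, hw, e, rfl⟩))
    rw [conj_conj] at this
    exact inner_self_eq_zero.1 (this _)
  · intro hh
    rw [Submodule.mem_orthogonal]
    intro u hu
    induction hu using Submodule.span_induction with
    | mem u hu =>
      obtain ⟨w, hw, e, rfl⟩ := hu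
      rw [inner_cauchyKernel hw.ne, hh _ (by simpa using hw), inner_zero_right]
    | zero => exact inner_zero_left _
    | add u v _ _ h1 h2 => rw [inner_add_left, h1, h2, add_zero]
    | smul c u _ h1 => rw [inner_smul_left, h1, mul_zero]

lemma cauchyKernel_mem_orthogonal {w : ℂ} (hw : 0 < w.im) (e : E) :
    (memLp_cauchyKernel_smul_const hw.ne' e).toLp ∈ (lowerKernelSpan E)ᗮ := by
  rw [mem_lowerKernelSpan_orthogonal_iff]
  intro z hz
  rw [cauchyIntegral_congr (memLp_cauchyKernel_smul_const hw.ne' e).coeFn_toLp]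
  unfold cauchyIntegral
  simp_rw [smul_smul]
  rw [integral_smul_const, integral_cauchyKernel_mul_of_im_pos hz hw, zero_smul, smul_zero]

/-- Kernels with poles above lie in H₋, so anything orthogonal to H₋ pairs to zero with them, which
is vanishing of the Cauchy integral below. -/
lemma cauchyIntegral_eq_zero_of_mem {h : Lp E 2 (volume : Measure ℝ)}
    (hh : h ∈ (lowerKernelSpan E)ᗮᗮ) {z : ℂ} (hz : z.im < 0) : cauchyIntegral h z = 0 := by
  have hw : 0 < (conj z).im := by simpa using hz
  have := fun e : E => (inner_cauchyKernel hw.ne' e h).symm.trans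
    (hh _ (cauchyKernel_mem_orthogonal hw e))
  rw [conj_conj] at this
  rw [cauchyIntegral, inner_self_eq_zero.1 (this _), smul_zero]

variable (E) in
/-- The orthogonal projection `-C⁻` of `L²(ℝ)` onto the Hardy space of the lower half-plane. -/
def hardyMinus : Lp E 2 (volume : Measure ℝ) →L[ℂ] Lp E 2 (volume : Measure ℝ) :=
  (lowerKernelSpan E)ᗮ.starProjection

variable (E) in
/-- The orthogonal projection `C⁺` of `L²(ℝ)` onto the Hardy space of the upper half-plane. -/
def hardyPlus : Lp E 2 (volume : Measure ℝ) →L[ℂ] Lp E 2 (volume : Measure ℝ) :=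
  ContinuousLinearMap.id ℂ _ - hardyMinus E

lemma hardyMinus_mem (h : Lp E 2 (volume : Measure ℝ)) : hardyMinus E h ∈ (lowerKernelSpan E)ᗮ :=
  Submodule.starProjection_apply_mem _ _

lemma hardyPlus_mem (h : Lp E 2 (volume : Measure ℝ)) : hardyPlus E h ∈ (lowerKernelSpan E)ᗮᗮ :=
  Submodule.sub_starProjection_mem_orthogonal _

lemma hardyPlus_add_hardyMinus (h : Lp E 2 (volume : Measure ℝ)) :
    hardyPlus E h + hardyMinus E h = h :=
  sub_add_cancel _ _

lemma hardyMinus_eq_self {h : Lp E 2 (volume : Measure ℝ)} (hh : h ∈ (lowerKernelSpan E)ᗮ) :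
    hardyMinus E h = h :=
  Submodule.starProjection_eq_self_iff.2 hh

lemma hardyMinus_hardyMinus (h : Lp E 2 (volume : Measure ℝ)) :
    hardyMinus E (hardyMinus E h) = hardyMinus E h :=
  hardyMinus_eq_self (hardyMinus_mem h)

lemma hardyPlus_hardyMinus (h : Lp E 2 (volume : Measure ℝ)) :
    hardyPlus E (hardyMinus E h) = 0 :=
  sub_eq_zero.2 (hardyMinus_hardyMinus h).symm

lemma hardyMinus_hardyPlus (h : Lp E 2 (volume : Measure ℝ)) :
    hardyMinus E (hardyPlus E h) = 0 := by
  change hardyMinus E (h - hardyMinus E h) = 0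
  rw [map_sub, hardyMinus_hardyMinus, sub_self]

lemma hardyPlus_hardyPlus (h : Lp E 2 (volume : Measure ℝ)) :
    hardyPlus E (hardyPlus E h) = hardyPlus E h := by
  have := hardyPlus_add_hardyMinus (hardyPlus E h)
  rwa [hardyMinus_hardyPlus, add_zero] at this

lemma inner_hardyMinus (h g : Lp E 2 (volume : Measure ℝ)) :
    inner ℂ (hardyMinus E h) g = inner ℂ h (hardyMinus E g) :=
  Submodule.inner_starProjection_left_eq_right _ _ _

lemma inner_hardyPlus_hardyMinus (h g : Lp E 2 (volume : Measure ℝ)) :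
    inner ℂ (hardyPlus E h) (hardyMinus E g) = 0 := by
  rw [← inner_hardyMinus, hardyMinus_hardyPlus, inner_zero_left]

lemma norm_sq_hardy (h : Lp E 2 (volume : Measure ℝ)) :
    ‖h‖ ^ 2 = ‖hardyPlus E h‖ ^ 2 + ‖hardyMinus E h‖ ^ 2 := by
  have := norm_add_sq_eq_norm_sq_add_norm_sq_of_inner_eq_zero _ _
    (inner_hardyPlus_hardyMinus h h)
  rw [hardyPlus_add_hardyMinus] at this
  simpa only [sq] using this

/-- In the splitting of f, the H₋ part contributes nothing above the line, and the H₊ part, having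
no Cauchy integral below, has itself as upper boundary value. -/
lemma isCauchyPlus_hardyPlus {f : ℝ → E} (hf : MemLp f 2) :
    IsCauchyPlus f (hardyPlus E hf.toLp) := by
  have h1 := isCauchyPlus_self (Lp.memLp (hardyPlus E hf.toLp))
    (fun z hz => cauchyIntegral_eq_zero_of_mem (hardyPlus_mem _) hz)
  have h2 := isCauchyPlus_zero
    (mem_lowerKernelSpan_orthogonal_iff.1 (hardyMinus_mem hf.toLp))
  have h3 := h1.add (Lp.memLp _) (Lp.memLp _) h2
  have h4 : f =ᵐ[volume] ⇑(hardyPlus E hf.toLp) + ⇑(hardyMinus E hf.toLp) := by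
    have := Lp.coeFn_add (hardyPlus E hf.toLp) (hardyMinus E hf.toLp)
    rw [hardyPlus_add_hardyMinus] at this
    exact hf.coeFn_toLp.symm.trans this
  rw [add_zero] at h3
  rwa [IsCauchyPlus, cauchyIntegral_congr h4]

lemma isCauchyMinus_hardyMinus {f : ℝ → E} (hf : MemLp f 2) :
    IsCauchyMinus f (fun x => -hardyMinus E hf.toLp x) := by
  have h1 := isCauchyMinus_zero
    (fun z hz => cauchyIntegral_eq_zero_of_mem (hardyPlus_mem hf.toLp) hz)
  have h2 := isCauchyMinus_neg_self (Lp.memLp (hardyMinus E hf.toLp))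
    (mem_lowerKernelSpan_orthogonal_iff.1 (hardyMinus_mem hf.toLp))
  have h3 := h1.add (Lp.memLp _) (Lp.memLp _) h2
  have h4 : f =ᵐ[volume] ⇑(hardyPlus E hf.toLp) + ⇑(hardyMinus E hf.toLp) := by
    have := Lp.coeFn_add (hardyPlus E hf.toLp) (hardyMinus E hf.toLp)
    rw [hardyPlus_add_hardyMinus] at this
    exact hf.coeFn_toLp.symm.trans this
  rw [zero_add] at h3
  rwa [IsCauchyMinus, cauchyIntegral_congr h4]

/-- The Hardy space of the lower half-plane is invariant under constant linear maps. -/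
lemma compLp_mem_orthogonal (L : E →L[ℂ] E) {h : Lp E 2 (volume : Measure ℝ)}
    (hh : h ∈ (lowerKernelSpan E)ᗮ) : L.compLp h ∈ (lowerKernelSpan E)ᗮ := by
  rw [mem_lowerKernelSpan_orthogonal_iff] at hh ⊢
  intro z hz
  rw [cauchyIntegral_congr (L.coeFn_compLp' h)]
  have := hh z hz
  unfold cauchyIntegral at this ⊢
  simp_rw [← map_smul]
  -- A constant linear map commutes with the Cauchy integral.
  rw [L.integral_comp_comm (integrable_cauchyKernel_smul (Lp.memLp h) hz.ne'), ← map_smul, this,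
    map_zero]

end Hardy

/-! ### Right multiplication by bounded matrix functions. -/

section MatrixMultiplication

lemma sq_norm_M2 (F : M2) : ‖F‖ ^ 2 = ∑ i, ∑ j, ‖F i j‖ ^ 2 := by
  rw [Matrix.frobenius_norm_def, ← Real.sqrt_eq_rpow, Real.sq_sqrt (by positivity)]
  simp_rw [Real.rpow_two]

/-- The Hilbert-Schmidt inner product of `2 × 2` matrices. -/
@[reducible]
def innerProductSpaceM2 : InnerProductSpace ℂ M2 where
  inner A B := ∑ i, ∑ j, conj (A i j) * B i j
  norm_sq_eq_re_inner A := by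
    rw [sq_norm_M2]
    simp_rw [conj_mul', map_sum]
    norm_cast
  conj_inner_symm A B := by simp [mul_comm]
  add_left A B C := by simp [add_mul]; ring
  smul_left A B c := by simp; ring

attribute [local instance] innerProductSpaceM2

lemma inner_M2 (A B : M2) : inner ℂ A B = ∑ i, ∑ j, conj (A i j) * B i j := rfl

/-- Matrix multiplication as a continuous bilinear map. -/
def matMul : M2 →L[ℂ] M2 →L[ℂ] M2 :=
  (LinearMap.mul ℂ M2).mkContinuous₂ 1 fun A B => by
    simpa using Matrix.frobenius_norm_mul A B

/-- Right multiplication of `L²` functions by a bounded matrix function. -/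
def mulRight {v : ℝ → M2} (hv : MemLinfty v) : L2M →L[ℂ] L2M :=
  (matMul.holderL volume 2 ∞ 2).flip hv.toLp

lemma coeFn_mulRight {v : ℝ → M2} (hv : MemLinfty v) (h : L2M) :
    mulRight hv h =ᵐ[volume] fun z => h z * v z := by
  filter_upwards [matMul.coeFn_holder (r := 2) h hv.toLp, hv.coeFn_toLp] with z h1 h2
  change matMul.holder 2 h hv.toLp z = _
  rw [h1, h2]
  rfl

lemma mulRight_eq_toLp {v : ℝ → M2} (hv : MemLinfty v) (h : L2M)
    (hm : MemLp (fun z => h z * v z) 2) : mulRight hv h = hm.toLp := by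
  refine Lp.ext ((coeFn_mulRight hv h).trans hm.coeFn_toLp.symm)

lemma memLp_mul {v : ℝ → M2} (hv : MemLinfty v) (h : L2M) : MemLp (fun z => h z * v z) 2 :=
  (memLp_congr_ae (coeFn_mulRight hv h)).1 (Lp.memLp _)

/-- Right multiplication by a constant matrix. -/
def mulRightConst (v₀ : M2) : M2 →L[ℂ] M2 := matMul.flip v₀

lemma sq_norm_L2M (f : L2M) : ‖f‖ ^ 2 = ∫ z, ‖f z‖ ^ 2 := by
  have h := L2.inner_def (𝕜 := ℂ) f f
  have h2 : ∀ z, inner ℂ (f z) (f z) = ((‖f z‖ ^ 2 : ℝ) : ℂ) := fun z => by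
    rw [inner_self_eq_norm_sq_to_K]
    push_cast
    rfl
  simp_rw [h2] at h
  rw [integral_complex_ofReal, inner_self_eq_norm_sq_to_K] at h
  exact Complex.ofReal_injective (by rw [ofReal_pow]; exact h)

end MatrixMultiplication

/-! ### Bijectivity of the Toeplitz operator and of the two singular integral operators. -/

section Toeplitz

attribute [local instance] innerProductSpaceM2

/-- Jump matrices with strictly positive real part away from a null set which are close to a fixed
invertible matrix wherever the real part degenerates. -/
structure IsAlmostCoercive (v : ℝ → M2) (v₀ : M2) : Prop where
  memLinfty : MemLinfty v
  exists_norm_le : ∃ K : ℝ, 0 < K ∧ ∀ F : M2, ‖F‖ ≤ K * ‖F * v₀‖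
  nonneg : ∀ᵐ z : ℝ, ∀ F : M2, 0 ≤ (inner ℂ F (F * v z)).re
  eq_zero : ∀ᵐ z : ℝ, ∀ F : M2, (inner ℂ F (F * v z)).re = 0 → F = 0
  sq_norm_le : ∀ ε : ℝ, 0 < ε → ∃ C : ℝ, 0 ≤ C ∧ ∀ᵐ z : ℝ, ∀ F : M2,
    ‖F * v z - F * v₀‖ ^ 2 ≤ ε * ‖F‖ ^ 2 + C * (inner ℂ F (F * v z)).re

/-- The Toeplitz operator `P₋ v P₋` on the Hardy space of the lower half-plane, extended by the
identity on its orthogonal complement. -/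
def toeplitz {v : ℝ → M2} (hv : MemLinfty v) : L2M →L[ℂ] L2M :=
  hardyPlus M2 + hardyMinus M2 ∘L mulRight hv ∘L hardyMinus M2

lemma toeplitz_apply {v : ℝ → M2} (hv : MemLinfty v) (f : L2M) :
    toeplitz hv f = hardyPlus M2 f + hardyMinus M2 (mulRight hv (hardyMinus M2 f)) := rfl

lemma hardyPlus_toeplitz {v : ℝ → M2} (hv : MemLinfty v) (f : L2M) :
    hardyPlus M2 (toeplitz hv f) = hardyPlus M2 f := by
  rw [toeplitz_apply, map_add, hardyPlus_hardyPlus, hardyPlus_hardyMinus, add_zero]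

lemma hardyMinus_toeplitz {v : ℝ → M2} (hv : MemLinfty v) (f : L2M) :
    hardyMinus M2 (toeplitz hv f) = hardyMinus M2 (mulRight hv (hardyMinus M2 f)) := by
  rw [toeplitz_apply, map_add, hardyMinus_hardyPlus, hardyMinus_hardyMinus, zero_add]

lemma inner_mulRight_re {v : ℝ → M2} (hv : MemLinfty v) (f : L2M) :
    Integrable (fun z => (inner ℂ (f z) (f z * v z)).re) ∧
      (inner ℂ f (mulRight hv f)).re = ∫ z, (inner ℂ (f z) (f z * v z)).re := by
  have h1 : (fun z => inner ℂ (f z) (mulRight hv f z)) =ᵐ[volume]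
      fun z => inner ℂ (f z) (f z * v z) := by
    filter_upwards [coeFn_mulRight hv f] with z hz
    rw [hz]
  have h2 := (L2.integrable_inner (𝕜 := ℂ) f (mulRight hv f)).congr h1
  refine ⟨h2.re, ?_⟩
  rw [L2.inner_def, integral_congr_ae h1]
  exact (integral_re h2).symm

lemma inner_toeplitz_re {v : ℝ → M2} (hv : MemLinfty v) (f : L2M) :
    (inner ℂ f (toeplitz hv f)).re = ‖hardyPlus M2 f‖ ^ 2 +
      (inner ℂ (hardyMinus M2 f) (mulRight hv (hardyMinus M2 f))).re := by
  have h1 : inner ℂ f (hardyPlus M2 f) = inner ℂ (hardyPlus M2 f) (hardyPlus M2 f) := by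
    conv_lhs => rw [← hardyPlus_add_hardyMinus f, map_add, hardyPlus_hardyPlus,
      hardyPlus_hardyMinus, add_zero, inner_add_left]
    rw [← hardyMinus_hardyMinus, inner_hardyMinus, hardyMinus_hardyPlus, inner_zero_right, add_zero]
  rw [toeplitz_apply, inner_add_right, h1, ← inner_hardyMinus, add_re, inner_self_eq_norm_sq_to_K]
  congr 1
  norm_cast

lemma IsAlmostCoercive.sq_norm_mulRight_sub_le {v : ℝ → M2} {v₀ : M2} (hc : IsAlmostCoercive v v₀)
    {ε : ℝ} (hε : 0 < ε) : ∃ C : ℝ, 0 ≤ C ∧ ∀ f : L2M,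
      ‖mulRight hc.memLinfty f - (mulRightConst v₀).compLp f‖ ^ 2 ≤
        ε * ‖f‖ ^ 2 + C * (inner ℂ f (mulRight hc.memLinfty f)).re := by
  obtain ⟨C, hC, h⟩ := hc.sq_norm_le ε hε
  refine ⟨C, hC, fun f => ?_⟩
  obtain ⟨h1, h2⟩ := inner_mulRight_re hc.memLinfty f
  have h3 : Integrable fun z => ‖f z‖ ^ 2 := (Lp.memLp f).integrable_norm_pow two_ne_zero
  rw [sq_norm_L2M, sq_norm_L2M, h2, ← integral_const_mul, ← integral_const_mul,
    ← integral_add (h3.const_mul _) (h1.const_mul _)]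
  refine integral_mono_ae ((Lp.memLp _).integrable_norm_pow two_ne_zero)
    ((h3.const_mul _).add (h1.const_mul _)) ?_
  filter_upwards [h, Lp.coeFn_sub (mulRight hc.memLinfty f) ((mulRightConst v₀).compLp f),
    coeFn_mulRight hc.memLinfty f, (mulRightConst v₀).coeFn_compLp' f] with z a b c d
  simp only [b, Pi.sub_apply, c, d]
  exact a (f z)

lemma norm_hardyMinus_le (f : L2M) : ‖hardyMinus M2 f‖ ≤ ‖f‖ := by
  have := norm_sq_hardy f
  exact abs_le_of_sq_le_sq' (by nlinarith [sq_nonneg ‖hardyPlus M2 f‖]) (norm_nonneg f) |>.2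

lemma norm_hardyPlus_le (f : L2M) : ‖hardyPlus M2 f‖ ≤ ‖f‖ := by
  have := norm_sq_hardy f
  exact abs_le_of_sq_le_sq' (by nlinarith [sq_nonneg ‖hardyMinus M2 f‖]) (norm_nonneg f) |>.2

/-- The arithmetic of the lower bound, with x = ‖f‖, y = ‖Tf‖, p = ‖P₊f‖, m = ‖P₋f‖, d the norm of
(P₋f)(v - v₀) and D the real part of the form at P₋f. The factor 1/(4k²) is chosen so that squaring
the bound on m leaves m²/2 to absorb. -/
lemma le_of_splitting_estimates {k C x y p m d D : ℝ} (hk : 0 < k) (hC : 0 ≤ C) (hx : 0 ≤ x)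
    (hy : 0 ≤ y) (hp0 : 0 ≤ p) (hm0 : 0 ≤ m) (hnorm : x ^ 2 = p ^ 2 + m ^ 2) (hp : p ≤ y)
    (hm : m ≤ k * (y + d)) (hD : p ^ 2 + D ≤ x * y)
    (hd : d ^ 2 ≤ 1 / (4 * k ^ 2) * m ^ 2 + C * D) :
    x ≤ (1 + 4 * k ^ 2 * (1 + C) + 1) * y := by
  set K : ℝ := 1 + 4 * k ^ 2 * (1 + C) with hK
  have hK0 : 0 ≤ K := by positivity
  have hm2 : m ^ 2 ≤ 2 * k ^ 2 * (y ^ 2 + d ^ 2) := by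
    have := pow_le_pow_left₀ hm0 hm 2
    nlinarith [sq_nonneg (k * (y - d))]
  have hD : D ≤ x * y := by linarith [sq_nonneg p]
  have hd2 : 2 * k ^ 2 * d ^ 2 ≤ m ^ 2 / 2 + 2 * k ^ 2 * (C * (x * y)) := by
    have h1 : d ^ 2 ≤ 1 / (4 * k ^ 2) * m ^ 2 + C * (x * y) :=
      hd.trans (by gcongr)
    have h2 : 2 * k ^ 2 * (1 / (4 * k ^ 2) * m ^ 2) = m ^ 2 / 2 := by
      field_simp
      norm_num
    have h3 : 2 * k ^ 2 * d ^ 2 ≤ 2 * k ^ 2 * (1 / (4 * k ^ 2) * m ^ 2 + C * (x * y)) := by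
      gcongr
    linarith
  have hm3 : m ^ 2 ≤ 4 * k ^ 2 * y ^ 2 + 4 * k ^ 2 * C * (x * y) := by linarith
  have hp2 : p ^ 2 ≤ y ^ 2 := pow_le_pow_left₀ hp0 hp 2
  have hxy : 0 ≤ x * y := mul_nonneg hx hy
  have hx2 : x ^ 2 ≤ K * (y ^ 2 + x * y) := by
    have : K * (y ^ 2 + x * y) = y ^ 2 + 4 * k ^ 2 * y ^ 2 + 4 * k ^ 2 * C * (x * y) + (x * y +
        4 * k ^ 2 * C * y ^ 2 + 4 * k ^ 2 * (x * y)) := by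
      rw [hK]
      ring
    have h4 : 0 ≤ x * y + 4 * k ^ 2 * C * y ^ 2 + 4 * k ^ 2 * (x * y) := by positivity
    linarith
  -- By Young's inequality Kxy ≤ x²/2 + K²y²/2, so x² ≤ (K² + 2K)y² ≤ (K + 1)²y².
  refine (abs_le_of_sq_le_sq' ?_ (by positivity)).2
  nlinarith [sq_nonneg (x - K * y), sq_nonneg y]

/-- The P₊ part of f is read off from Tf. For g = P₋f, the function gv₀ stays in H₋, so it differs
from P₋(gv) by at most ‖g(v - v₀)‖, which the form controls up to a small multiple of ‖g‖; the form
itself is at most ‖f‖‖Tf‖. -/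
lemma IsAlmostCoercive.toeplitz_bounded_below {v : ℝ → M2} {v₀ : M2} (hc : IsAlmostCoercive v v₀) :
    ∃ K : ℝ, 0 ≤ K ∧ ∀ f : L2M, ‖f‖ ≤ K * ‖toeplitz hc.memLinfty f‖ := by
  obtain ⟨k, hk, hk'⟩ := hc.exists_norm_le
  obtain ⟨C, hC, hle⟩ := hc.sq_norm_mulRight_sub_le (ε := 1 / (4 * k ^ 2)) (by positivity)
  have hR : ∀ f : L2M, ‖f‖ ≤ k * ‖(mulRightConst v₀).compLp f‖ := by
    intro f
    refine Lp.norm_le_mul_norm_of_ae_le_mul ?_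
    filter_upwards [(mulRightConst v₀).coeFn_compLp' f] with z hz
    rw [hz]
    exact hk' _
  refine ⟨1 + 4 * k ^ 2 * (1 + C) + 1, by positivity, fun f => ?_⟩
  have hnorm := norm_sq_hardy f
  have hre := inner_toeplitz_re hc.memLinfty f
  have hcs := (re_le_norm _).trans (norm_inner_le_norm (𝕜 := ℂ) f (toeplitz hc.memLinfty f))
  have hp := norm_hardyPlus_le (toeplitz hc.memLinfty f)
  rw [hardyPlus_toeplitz] at hp
  have hm := norm_hardyMinus_le (toeplitz hc.memLinfty f)
  rw [hardyMinus_toeplitz] at hm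
  have hle := hle (hardyMinus M2 f)
  have hR := hR (hardyMinus M2 f)
  have hfix := hardyMinus_eq_self
    (compLp_mem_orthogonal (mulRightConst v₀) (hardyMinus_mem f))
  have hRd : ‖(mulRightConst v₀).compLp (hardyMinus M2 f)‖ ≤ ‖toeplitz hc.memLinfty f‖ +
      ‖mulRight hc.memLinfty (hardyMinus M2 f) - (mulRightConst v₀).compLp (hardyMinus M2 f)‖ := by
    set R := (mulRightConst v₀).compLp (hardyMinus M2 f)
    have e : R = hardyMinus M2 (mulRight hc.memLinfty (hardyMinus M2 f)) -
        hardyMinus M2 (mulRight hc.memLinfty (hardyMinus M2 f) - R) := by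
      rw [map_sub, hfix, sub_sub_cancel]
    exact (congrArg norm e).trans_le <|
      (norm_sub_le _ _).trans (add_le_add hm (norm_hardyMinus_le _))
  have hm1 := hR.trans (mul_le_mul_of_nonneg_left hRd hk.le)
  replace hcs : (inner ℂ f (toeplitz hc.memLinfty f)).re ≤ ‖f‖ * ‖toeplitz hc.memLinfty f‖ := hcs
  rw [hre] at hcs
  generalize ‖mulRight hc.memLinfty (hardyMinus M2 f) - (mulRightConst v₀).compLp (hardyMinus M2 f)‖
    = d at hm1 hle
  exact le_of_splitting_estimates hk hC (norm_nonneg _) (norm_nonneg _) (norm_nonneg _)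
    (norm_nonneg _) hnorm hp hm1 hcs hle

/-- The lower bound gives injectivity and closed range. If g is orthogonal to the range, testing
against Tg makes ‖P₊g‖² and the form at P₋g vanish, both being nonnegative. -/
lemma IsAlmostCoercive.toeplitz_bijective {v : ℝ → M2} {v₀ : M2} (hc : IsAlmostCoercive v v₀) :
    Function.Bijective (toeplitz hc.memLinfty) := by
  obtain ⟨K, hK, hb⟩ := hc.toeplitz_bounded_below
  have hanti : AntilipschitzWith ⟨K, hK⟩ (toeplitz hc.memLinfty) :=
    (toeplitz hc.memLinfty).antilipschitz_of_bound hb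
  refine ⟨hanti.injective, ?_⟩
  have hclosed := hanti.isClosed_range (toeplitz hc.memLinfty).uniformContinuous
  have : CompleteSpace (toeplitz hc.memLinfty).range :=
    (show IsClosed ((toeplitz hc.memLinfty).range : Set L2M) from hclosed).completeSpace_coe
  suffices (toeplitz hc.memLinfty).range = ⊤ from LinearMap.range_eq_top.1 this
  rw [← Submodule.orthogonal_eq_bot_iff, Submodule.eq_bot_iff]
  intro g hg
  have h0 : inner ℂ g (toeplitz hc.memLinfty g) = 0 := by
    have h1 : inner ℂ (toeplitz hc.memLinfty g) g = 0 := hg _ ⟨g, rfl⟩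
    rw [← inner_conj_symm, h1, map_zero]
  have hre := inner_toeplitz_re hc.memLinfty g
  obtain ⟨hint, heq⟩ := inner_mulRight_re hc.memLinfty (hardyMinus M2 g)
  have hpos : ∀ᵐ z, 0 ≤ (inner ℂ (hardyMinus M2 g z) (hardyMinus M2 g z * v z)).re := by
    filter_upwards [hc.nonneg] with z hz using hz _
  have hnn := integral_nonneg_of_ae hpos
  rw [h0, heq, zero_re] at hre
  have hp : hardyPlus M2 g = 0 := by
    rw [← norm_eq_zero, ← sq_eq_zero_iff]
    linarith [sq_nonneg ‖hardyPlus M2 g‖]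
  have hm0 : ∫ z, (inner ℂ (hardyMinus M2 g z) (hardyMinus M2 g z * v z)).re = 0 := by
    linarith [sq_nonneg ‖hardyPlus M2 g‖]
  have hm : hardyMinus M2 g = 0 := by
    rw [Lp.eq_zero_iff_ae_eq_zero]
    filter_upwards [(integral_eq_zero_iff_of_nonneg_ae hpos hint).1 hm0, hc.eq_zero] with z h1 h2
    exact h2 _ h1
  rw [← hardyPlus_add_hardyMinus g, hp, hm, add_zero]

/-- The singular integral operator `P₊ + P₋ v` is bijective. -/
lemma IsAlmostCoercive.bijective_add_hardyMinus_mulRight {v : ℝ → M2} {v₀ : M2}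
    (hc : IsAlmostCoercive v v₀) :
    Function.Bijective (hardyPlus M2 + hardyMinus M2 ∘L mulRight hc.memLinfty) := by
  obtain ⟨hi, hs⟩ := hc.toeplitz_bijective
  constructor
  · rw [injective_iff_map_eq_zero]
    intro f hf
    change hardyPlus M2 f + hardyMinus M2 (mulRight hc.memLinfty f) = 0 at hf
    have hp : hardyPlus M2 f = 0 := by
      simpa [hardyPlus_hardyPlus, hardyPlus_hardyMinus] using congrArg (hardyPlus M2) hf
    have hm : hardyMinus M2 f = f := by
      have := hardyPlus_add_hardyMinus f
      rwa [hp, zero_add] at this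
    apply hi
    rw [toeplitz_apply, hm, hf, map_zero]
  · intro u
    -- The P₊ component of a preimage must be P₊u; its P₋ component g then solves a Toeplitz
    -- equation with the contribution of P₊u subtracted.
    obtain ⟨g, hg⟩ := hs (hardyMinus M2 (u - mulRight hc.memLinfty (hardyPlus M2 u)))
    have hp : hardyPlus M2 g = 0 := by
      rw [← hardyPlus_toeplitz hc.memLinfty, hg, hardyPlus_hardyMinus]
    have hm : hardyMinus M2 g = g := by
      have := hardyPlus_add_hardyMinus g
      rwa [hp, zero_add] at this
    rw [toeplitz_apply, hp, hm, zero_add, map_sub] at hg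
    refine ⟨hardyPlus M2 u + g, ?_⟩
    change hardyPlus M2 (hardyPlus M2 u + g) +
      hardyMinus M2 (mulRight hc.memLinfty (hardyPlus M2 u + g)) = u
    rw [map_add, map_add, map_add, hardyPlus_hardyPlus, hp, hg, add_zero, add_sub_cancel,
      hardyPlus_add_hardyMinus]

/-- The singular integral operator `P₊ + v P₋` is bijective. -/
lemma IsAlmostCoercive.bijective_add_mulRight_hardyMinus {v : ℝ → M2} {v₀ : M2}
    (hc : IsAlmostCoercive v v₀) :
    Function.Bijective (hardyPlus M2 + mulRight hc.memLinfty ∘L hardyMinus M2) := by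
  obtain ⟨hi, hs⟩ := hc.toeplitz_bijective
  constructor
  · rw [injective_iff_map_eq_zero]
    intro f hf
    change hardyPlus M2 f + mulRight hc.memLinfty (hardyMinus M2 f) = 0 at hf
    have h1 : hardyMinus M2 (mulRight hc.memLinfty (hardyMinus M2 f)) = 0 := by
      simpa [hardyMinus_hardyPlus] using congrArg (hardyMinus M2) hf
    have hm : hardyMinus M2 f = 0 := by
      apply hi
      rw [toeplitz_apply, hardyPlus_hardyMinus, hardyMinus_hardyMinus, h1, map_zero, add_zero]
    rw [hm, map_zero, add_zero] at hf
    rw [← hardyPlus_add_hardyMinus f, hf, hm, add_zero]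
  · intro u
    -- Applying P₋ to the equation involves only the P₋ component g; the P₊ component is then
    -- explicit.
    obtain ⟨g, hg⟩ := hs (hardyMinus M2 u)
    have hp : hardyPlus M2 g = 0 := by
      rw [← hardyPlus_toeplitz hc.memLinfty, hg, hardyPlus_hardyMinus]
    have hm : hardyMinus M2 g = g := by
      have := hardyPlus_add_hardyMinus g
      rwa [hp, zero_add] at this
    rw [toeplitz_apply, hp, hm, zero_add] at hg
    refine ⟨g + hardyPlus M2 (u - mulRight hc.memLinfty g), ?_⟩
    change hardyPlus M2 (g + hardyPlus M2 (u - mulRight hc.memLinfty g)) +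
      mulRight hc.memLinfty (hardyMinus M2 (g + hardyPlus M2 (u - mulRight hc.memLinfty g))) = u
    rw [map_add, map_add, hp, hm, hardyPlus_hardyPlus, hardyMinus_hardyPlus, add_zero, zero_add,
      map_sub]
    have h2 := hardyPlus_add_hardyMinus (mulRight hc.memLinfty g)
    rw [hg] at h2
    rw [← h2, ← add_assoc, map_add, hardyPlus_hardyPlus, hardyPlus_hardyMinus, add_zero,
      sub_add_cancel, hardyPlus_add_hardyMinus]

end Toeplitz

attribute [local instance] innerProductSpaceM2

/-! ### Almost-coercivity of the KdV jump matrix. -/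

section Jump

variable {r : ℝ → ℂ} {x t : ℝ}

/-- The lower left entry `r e^{2iτ}` of the jump matrix. -/
def kdvPhase (r : ℝ → ℂ) (x t z : ℝ) : ℂ :=
  r z * exp (2 * I * ((x * z + 4 * t * z ^ 3 : ℝ) : ℂ))

lemma norm_kdvPhase (z : ℝ) : ‖kdvPhase r x t z‖ = ‖r z‖ := by
  have h : 2 * I * ((x * z + 4 * t * z ^ 3 : ℝ) : ℂ) =
      ((2 * (x * z + 4 * t * z ^ 3) : ℝ) : ℂ) * I := by
    push_cast
    ring
  rw [kdvPhase, norm_mul, h, norm_exp_ofReal_mul_I, mul_one]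

lemma kdvJump_eq (z : ℝ) : kdvJump r x t z =
    !![((1 - ‖r z‖ ^ 2 : ℝ) : ℂ), -conj (kdvPhase r x t z); kdvPhase r x t z, 1] := by
  have h : conj (exp (2 * I * ((x * z + 4 * t * z ^ 3 : ℝ) : ℂ))) =
      exp (-(2 * I * ((x * z + 4 * t * z ^ 3 : ℝ) : ℂ))) := by
    rw [← exp_conj]
    congr 1
    rw [map_mul, map_mul, conj_I, conj_ofReal, Complex.conj_ofNat]
    ring
  simp only [kdvJump, kdvPhase, map_mul, h]
  push_cast
  ring_nf

lemma continuous_kdvJump (hr : Continuous r) : Continuous (kdvJump r x t) := by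
  have h : Continuous (kdvPhase r x t) := by unfold kdvPhase; fun_prop
  have e : kdvJump r x t = fun z => !![((1 - ‖r z‖ ^ 2 : ℝ) : ℂ), -conj (kdvPhase r x t z);
    kdvPhase r x t z, 1] := funext kdvJump_eq
  rw [e]
  refine continuous_matrix fun i j => ?_
  fin_cases i <;> fin_cases j <;> simp <;> fun_prop

lemma aestronglyMeasurable_of_continuous {E : Type*} [NormedAddCommGroup E] {f : ℝ → E}
    (hf : Continuous f) : AEStronglyMeasurable f := hf.aestronglyMeasurable

lemma aestronglyMeasurable_kdvJump (hr : Continuous r) :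
    AEStronglyMeasurable (kdvJump r x t) volume :=
  aestronglyMeasurable_of_continuous (E := M2) (continuous_kdvJump hr)

/-- The off-diagonal part of the jump matrix is skew-Hermitian, so it drops out of the real part. -/
lemma inner_mul_kdvJump_re (F : M2) (z : ℝ) : (inner ℂ F (F * kdvJump r x t z)).re =
    ∑ i, ((1 - ‖r z‖ ^ 2) * ‖F i 0‖ ^ 2 + ‖F i 1‖ ^ 2) := by
  rw [inner_M2, kdvJump_eq]
  simp only [Fin.sum_univ_two, Matrix.mul_apply, Complex.sq_norm, normSq_apply, Matrix.of_apply,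
    Matrix.cons_val_zero, Matrix.cons_val_one, Matrix.cons_val', Matrix.cons_val_fin_one,
    add_re, mul_re, mul_im, add_im, neg_re, neg_im, conj_re, conj_im, ofReal_re, ofReal_im,
    one_re, one_im]
  ring

/-- The squared norm is |r|⁴ + 2|r|², at most 3|r|². Thus `r` in `L²` puts v - 1 in `L²`. -/
lemma norm_kdvJump_sub_one_le (hr : ∀ z, ‖r z‖ ≤ 1) (z : ℝ) :
    ‖kdvJump r x t z - 1‖ ≤ 2 * ‖r z‖ := by
  refine (abs_le_of_sq_le_sq' ?_ (by positivity)).2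
  have h2 : ‖r z‖ ^ 2 ≤ 1 := pow_le_one₀ (norm_nonneg _) (hr z)
  have h3 : 0 ≤ ‖r z‖ ^ 2 := by positivity
  rw [sq_norm_M2, kdvJump_eq]
  simp [Fin.sum_univ_two, norm_kdvPhase]
  nlinarith

lemma memLinfty_kdvJump (hcont : Continuous r) (hr : ∀ z, ‖r z‖ ≤ 1) :
    MemLinfty (kdvJump r x t) := by
  refine memLp_top_of_bound (aestronglyMeasurable_kdvJump hcont) (2 + ‖(1 : M2)‖)
    (Eventually.of_forall fun z => ?_)
  calc ‖kdvJump r x t z‖ = ‖(kdvJump r x t z - 1) + 1‖ := by rw [sub_add_cancel]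
    _ ≤ ‖kdvJump r x t z - 1‖ + ‖(1 : M2)‖ := norm_add_le _ _
    _ ≤ 2 + ‖(1 : M2)‖ := by linarith [norm_kdvJump_sub_one_le (x := x) (t := t) hr z, hr z]

lemma memLp_kdvJump_sub_one (hcont : Continuous r) (hr : ∀ z, ‖r z‖ ≤ 1) (h2 : MemLp r 2) :
    MemLp (fun z => kdvJump r x t z - 1) 2 :=
  h2.of_le_mul ((aestronglyMeasurable_kdvJump hcont).sub aestronglyMeasurable_const)
    (Eventually.of_forall fun z => norm_kdvJump_sub_one_le hr z)

/-- Decay at infinity handles the outside of a compact set; on its part away from 0 the continuous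
function 1 - |r|² attains a positive minimum. -/
lemma exists_le_one_sub_sq_norm (hcont : Continuous r) (hlt : ∀ z : ℝ, z ≠ 0 → ‖r z‖ < 1)
    (hinfty : Tendsto r (cocompact ℝ) (𝓝 0)) {δ : ℝ} (hδ : 0 < δ) :
    ∃ κ : ℝ, 0 < κ ∧ κ ≤ 1 ∧ ∀ z : ℝ, δ ≤ |z| → κ ≤ 1 - ‖r z‖ ^ 2 := by
  have hc : Continuous fun z => 1 - ‖r z‖ ^ 2 := by fun_prop
  have h0 : Tendsto (fun z => 1 - ‖r z‖ ^ 2) (cocompact ℝ) (𝓝 1) := by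
    simpa using (hinfty.norm.pow 2).const_sub 1
  obtain ⟨S, hS, hS'⟩ := mem_cocompact.1 (h0.eventually_const_le (show (1 / 2 : ℝ) < 1 by norm_num))
  have hT : IsCompact (S ∩ {z : ℝ | δ ≤ |z|}) :=
    hS.inter_right (isClosed_le continuous_const continuous_abs)
  have hout : ∀ z, z ∉ S → 1 / 2 ≤ 1 - ‖r z‖ ^ 2 := fun z hz => hS' hz
  rcases (S ∩ {z : ℝ | δ ≤ |z|}).eq_empty_or_nonempty with he | hne
  · refine ⟨1 / 2, by norm_num, by norm_num, fun z hz => hout z fun hzS => ?_⟩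
    exact (he ▸ (⟨hzS, hz⟩ : z ∈ S ∩ {z : ℝ | δ ≤ |z|}) : z ∈ (∅ : Set ℝ))
  · obtain ⟨w, hw, hmin⟩ := hT.exists_isMinOn hne hc.continuousOn
    have hw1 : ‖r w‖ < 1 := hlt w (abs_pos.1 (hδ.trans_le hw.2))
    have hw2 : ‖r w‖ ^ 2 < 1 := pow_lt_one₀ (norm_nonneg _) hw1 two_ne_zero
    refine ⟨min (1 / 2) (1 - ‖r w‖ ^ 2), lt_min (by norm_num) (by linarith),
      (min_le_left _ _).trans (by norm_num), fun z hz => ?_⟩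
    by_cases hzS : z ∈ S
    · exact (min_le_right _ _).trans (hmin ⟨hzS, hz⟩)
    · exact (min_le_left _ _).trans (hout z hzS)

lemma isAlmostCoercive_kdvJump (hcont : Continuous r) (hlt : ∀ z : ℝ, z ≠ 0 → ‖r z‖ < 1)
    (hr : ∀ z, ‖r z‖ ≤ 1) (hinfty : Tendsto r (cocompact ℝ) (𝓝 0)) :
    IsAlmostCoercive (kdvJump r x t) (kdvJump r x t 0) where
  memLinfty := memLinfty_kdvJump hcont hr
  exists_norm_le := by
    have hdet : (kdvJump r x t 0).det = 1 := by
      rw [kdvJump_eq, Matrix.det_fin_two_of, neg_mul, conj_mul', norm_kdvPhase]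
      push_cast
      ring
    refine ⟨‖(kdvJump r x t 0)⁻¹‖ + 1, by positivity, fun F => ?_⟩
    calc ‖F‖ = ‖F * kdvJump r x t 0 * (kdvJump r x t 0)⁻¹‖ := by
          rw [Matrix.mul_nonsing_inv_cancel_right _ _ (by simp [hdet])]
      _ ≤ ‖F * kdvJump r x t 0‖ * ‖(kdvJump r x t 0)⁻¹‖ := Matrix.frobenius_norm_mul _ _
      _ ≤ _ := by
          rw [mul_comm]
          gcongr
          linarith
  nonneg := Eventually.of_forall fun z F => by
    rw [inner_mul_kdvJump_re]
    have : ‖r z‖ ^ 2 ≤ 1 := pow_le_one₀ (norm_nonneg _) (hr z)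
    have : 0 ≤ 1 - ‖r z‖ ^ 2 := by linarith
    positivity
  eq_zero := by
    have h0 : ∀ᵐ z : ℝ, z ≠ 0 := by simp [ae_iff]
    filter_upwards [h0] with z hz F hF
    rw [inner_mul_kdvJump_re] at hF
    have h1 : 0 < 1 - ‖r z‖ ^ 2 := by
      linarith [pow_lt_one₀ (norm_nonneg _) (hlt z hz) two_ne_zero]
    rw [Finset.sum_eq_zero_iff_of_nonneg fun i _ => by positivity] at hF
    ext i j
    have h2 := hF i (Finset.mem_univ i)
    rw [add_eq_zero_iff_of_nonneg (by positivity) (by positivity)] at h2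
    fin_cases j
    · simpa [h1.ne'] using h2.1
    · simpa using h2.2
  sq_norm_le := fun ε hε => by
    have hct := ((continuous_kdvJump (x := x) (t := t) hcont).sub
      (continuous_const (y := kdvJump r x t 0))).norm.pow 2
    have hnear : ∀ᶠ z in 𝓝 (0 : ℝ), ‖kdvJump r x t z - kdvJump r x t 0‖ ^ 2 ≤ ε := by
      refine (hct.tendsto 0).eventually_le_const ?_
      simpa using hε
    obtain ⟨δ, hδ, hball⟩ := Metric.eventually_nhds_iff.1 hnear
    obtain ⟨κ, hκ, hκ1, hfar⟩ := exists_le_one_sub_sq_norm hcont hlt hinfty hδ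
    have hbd : ∀ z, ‖kdvJump r x t z - kdvJump r x t 0‖ ^ 2 ≤ 16 := fun z => by
      have h1 := norm_kdvJump_sub_one_le (x := x) (t := t) hr z
      have h2 := norm_kdvJump_sub_one_le (x := x) (t := t) hr 0
      have h3 : ‖kdvJump r x t z - kdvJump r x t 0‖ ≤ 4 := by
        rw [← sub_sub_sub_cancel_right _ _ (1 : M2)]
        linarith [norm_sub_le (kdvJump r x t z - 1) (kdvJump r x t 0 - 1), hr z, hr 0]
      nlinarith [norm_nonneg (kdvJump r x t z - kdvJump r x t 0)]
    -- Within δ of 0 continuity gives the ε term. Outside, the form is at least κ‖F‖², while the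
    -- deviation from v(0) is at most 16‖F‖².
    refine ⟨16 / κ, by positivity, Eventually.of_forall fun z F => ?_⟩
    have hmul : ‖F * kdvJump r x t z - F * kdvJump r x t 0‖ ^ 2 ≤
        ‖kdvJump r x t z - kdvJump r x t 0‖ ^ 2 * ‖F‖ ^ 2 := by
      rw [← Matrix.mul_sub, ← mul_pow, mul_comm ‖kdvJump r x t z - _‖]
      exact pow_le_pow_left₀ (norm_nonneg _) (Matrix.frobenius_norm_mul _ _) 2
    refine hmul.trans ?_
    rw [inner_mul_kdvJump_re]
    have hr2 : 0 ≤ 1 - ‖r z‖ ^ 2 := by linarith [pow_le_one₀ (norm_nonneg _) (hr z) (n := 2)]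
    rcases lt_or_ge |z| δ with hz | hz
    · have := hball (y := z) (by simpa [Real.dist_eq] using hz)
      calc _ ≤ ε * ‖F‖ ^ 2 := by gcongr
        _ ≤ _ := le_add_of_nonneg_right (by positivity)
    · have hk := hfar z hz
      have hq : κ * ‖F‖ ^ 2 ≤ ∑ i, ((1 - ‖r z‖ ^ 2) * ‖F i 0‖ ^ 2 + ‖F i 1‖ ^ 2) := by
        rw [sq_norm_M2, Finset.mul_sum]
        refine Finset.sum_le_sum fun i _ => ?_
        rw [Fin.sum_univ_two, mul_add]
        gcongr
        exact mul_le_of_le_one_left (by positivity) hκ1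
      calc _ ≤ 16 * ‖F‖ ^ 2 := by gcongr; exact hbd z
        _ = 16 / κ * (κ * ‖F‖ ^ 2) := by field_simp
        _ ≤ 16 / κ * ∑ i, ((1 - ‖r z‖ ^ 2) * ‖F i 0‖ ^ 2 + ‖F i 1‖ ^ 2) := by gcongr
        _ ≤ _ := le_add_of_nonneg_left (by positivity)

end Jump

/-! ### The operator of a factorization. -/

section Factorization

lemma memLinfty_one : MemLinfty (fun _ : ℝ => (1 : M2)) :=
  memLp_top_of_bound aestronglyMeasurable_const _ (Eventually.of_forall fun _ => le_rfl)

lemma mulRight_mulRight {u v w : ℝ → M2} (hu : MemLinfty u) (hv : MemLinfty v) (hw : MemLinfty w)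
    (h : ∀ᵐ z : ℝ, u z * v z = w z) (f : L2M) :
    mulRight hv (mulRight hu f) = mulRight hw f := by
  refine Lp.ext ?_
  filter_upwards [coeFn_mulRight hv (mulRight hu f), coeFn_mulRight hu f, coeFn_mulRight hw f, h]
    with z a b c d
  rw [a, b, c, Matrix.mul_assoc, d]

lemma mulRight_one (f : L2M) : mulRight memLinfty_one f = f := by
  refine Lp.ext ?_
  filter_upwards [coeFn_mulRight memLinfty_one f] with z hz
  rw [hz, mul_one]

lemma mulRight_sub {u v : ℝ → M2} (hu : MemLinfty u) (hv : MemLinfty v)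
    (huv : MemLinfty fun z => u z - v z) (f : L2M) :
    mulRight huv f = mulRight hu f - mulRight hv f := by
  refine Lp.ext ?_
  filter_upwards [coeFn_mulRight huv f, coeFn_mulRight hu f, coeFn_mulRight hv f,
    Lp.coeFn_sub (mulRight hu f) (mulRight hv f)] with z a b c d
  rw [a, d, Pi.sub_apply, b, c, Matrix.mul_sub]

variable {v vm vp : ℝ → M2}

/-- The operator `C_ω` of a factorization. -/
def basicOperator (hf : IsFactorization v vm vp) : L2M →L[ℂ] L2M :=
  hardyPlus M2 ∘L mulRight (memLinfty_one.sub hf.memLp_minus) -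
    hardyMinus M2 ∘L mulRight (hf.memLp_plus.sub memLinfty_one)

lemma isBasicOperator_basicOperator (hf : IsFactorization v vm vp) :
    IsBasicOperator (fun z => 1 - vm z) (fun z => vp z - 1) (basicOperator hf) := by
  intro h
  have hm : MemLinfty fun z => 1 - vm z := memLinfty_one.sub hf.memLp_minus
  have hp : MemLinfty fun z => vp z - 1 := hf.memLp_plus.sub memLinfty_one
  refine ⟨_, _, isCauchyPlus_hardyPlus (memLp_mul hm h), isCauchyMinus_hardyMinus (memLp_mul hp h),
    ?_⟩
  have e : basicOperator hf h = hardyPlus M2 (memLp_mul hm h).toLp -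
      hardyMinus M2 (memLp_mul hp h).toLp := by
    rw [← mulRight_eq_toLp hm, ← mulRight_eq_toLp hp]
    rfl
  rw [e]
  filter_upwards [Lp.coeFn_sub (hardyPlus M2 (memLp_mul hm h).toLp)
    (hardyMinus M2 (memLp_mul hp h).toLp)] with z hz
  rw [hz, Pi.sub_apply, sub_eq_add_neg]

/-- Since v⁻v = v⁺, expanding 1 = P₊ + P₋ turns 1 - P₊(1 - v⁻) + P₋(v⁺ - 1) into P₊v⁻ + P₋v⁺. This
confines the dependence on the factorization to an invertible right factor. -/
lemma id_sub_basicOperator (hf : IsFactorization v vm vp) (hv : MemLinfty v) :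
    ⇑(ContinuousLinearMap.id ℂ L2M - basicOperator hf) =
      ⇑(hardyPlus M2 + hardyMinus M2 ∘L mulRight hv) ∘ mulRight hf.memLp_minus := by
  funext f
  have h1 := mulRight_sub memLinfty_one hf.memLp_minus (memLinfty_one.sub hf.memLp_minus) f
  have h2 := mulRight_sub hf.memLp_plus memLinfty_one (hf.memLp_plus.sub memLinfty_one) f
  have h3 : mulRight hv (mulRight hf.memLp_minus f) = mulRight hf.memLp_plus f := by
    refine mulRight_mulRight _ _ _ ?_ f
    filter_upwards [hf.eq_mul, hf.isUnit_minus] with z a b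
    rw [a, Matrix.mul_nonsing_inv_cancel_left _ _ ((Matrix.isUnit_iff_isUnit_det _).1 b)]
  change f - (hardyPlus M2 (mulRight (memLinfty_one.sub hf.memLp_minus) f) -
    hardyMinus M2 (mulRight (hf.memLp_plus.sub memLinfty_one) f)) =
    hardyPlus M2 (mulRight hf.memLp_minus f) +
      hardyMinus M2 (mulRight hv (mulRight hf.memLp_minus f))
  rw [h1, h2, h3, mulRight_one, map_sub, map_sub]
  conv_lhs => enter [1]; rw [← hardyPlus_add_hardyMinus f]
  abel

lemma mulRight_bijective (hf : IsFactorization v vm vp) :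
    Function.Bijective (mulRight hf.memLp_minus) := by
  refine Function.bijective_iff_has_inverse.2
    ⟨mulRight hf.memLp_inv_minus, fun f => ?_, fun f => ?_⟩
  · rw [mulRight_mulRight _ _ memLinfty_one _ f, mulRight_one]
    filter_upwards [hf.isUnit_minus] with z b
    exact Matrix.mul_nonsing_inv _ ((Matrix.isUnit_iff_isUnit_det _).1 b)
  · rw [mulRight_mulRight _ _ memLinfty_one _ f, mulRight_one]
    filter_upwards [hf.isUnit_minus] with z b
    exact Matrix.nonsing_inv_mul _ ((Matrix.isUnit_iff_isUnit_det _).1 b)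

lemma IsAlmostCoercive.id_sub_basicOperator_bijective {v₀ : M2} (hc : IsAlmostCoercive v v₀)
    (hf : IsFactorization v vm vp) :
    Function.Bijective (ContinuousLinearMap.id ℂ L2M - basicOperator hf) := by
  rw [id_sub_basicOperator hf hc.memLinfty]
  exact hc.bijective_add_hardyMinus_mulRight.comp (mulRight_bijective hf)

end Factorization

/-! ### Bijective operators are Fredholm of index 0. -/

section Fredholm

variable {X Y : Type*} [NormedAddCommGroup X] [NormedSpace ℂ X]
  [NormedAddCommGroup Y] [NormedSpace ℂ Y]

lemma isFredholm_of_bijective [CompleteSpace X] [CompleteSpace Y] {T : X →L[ℂ] Y}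
    (hT : Function.Bijective T) : T.IsFredholm := by
  have hker : T.ker = ⊥ := LinearMap.ker_eq_bot.2 hT.1
  have hrange : T.range = ⊤ := LinearMap.range_eq_top.2 hT.2
  refine ⟨?_, ?_, ?_, ?_, ?_⟩
  · exact (ContinuousLinearEquiv.ofBijective T hker hrange).toHomeomorph.isHomeomorph.isStrictMap
  · rw [hrange]
    exact isClosed_univ
  · rw [hker]
    infer_instance
  · rw [hrange]
    exact Submodule.CoFG.top
  · rw [hker]
    exact Submodule.closedComplemented_bot

lemma fredholmIndex_eq_zero_of_bijective {T : X →L[ℂ] Y} (hT : Function.Bijective T) :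
    fredholmIndex T = 0 := by
  have hker : T.ker = ⊥ := LinearMap.ker_eq_bot.2 hT.1
  have hrange : T.range = ⊤ := LinearMap.range_eq_top.2 hT.2
  have : Subsingleton (Y ⧸ (⊤ : Submodule ℂ Y)) :=
    Submodule.Quotient.subsingleton_iff.2 rfl
  rw [fredholmIndex, hker, hrange, finrank_bot, Module.finrank_zero_of_subsingleton]
  simp

end Fredholm

/-! ### The normalized Riemann–Hilbert problem. -/

section NormalizedProblem

variable {v : ℝ → M2} {v₀ : M2}

/-- Normalized solutions correspond to solutions of `(P₊ + v P₋) h = v - 1`. -/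
lemma singularIntegral_of_solves (hv : MemLinfty v) (h2 : MemLp (fun z => v z - 1) 2)
    {mp mm h : ℝ → M2} (hh : MemLp h 2) (hp : IsCauchyPlus h fun z => mp z - 1)
    (hm : IsCauchyMinus h fun z => mm z - 1) (hjump : ∀ᵐ z : ℝ, mp z = mm z * v z) :
    (hardyPlus M2 + mulRight hv ∘L hardyMinus M2) hh.toLp = h2.toLp := by
  refine Lp.ext ?_
  change ⇑(hardyPlus M2 hh.toLp + mulRight hv (hardyMinus M2 hh.toLp)) =ᵐ[volume] _
  filter_upwards [Lp.coeFn_add (hardyPlus M2 hh.toLp) (mulRight hv (hardyMinus M2 hh.toLp)),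
    coeFn_mulRight hv (hardyMinus M2 hh.toLp), h2.coeFn_toLp, hjump,
    hp.ae_eq (isCauchyPlus_hardyPlus hh), hm.ae_eq (isCauchyMinus_hardyMinus hh)] with z a b c d e f
  -- With P₊h = m₊ - 1 and P₋h = 1 - m₋, the left side is m₋v - 1 + (1 - m₋)v = v - 1.
  rw [a, Pi.add_apply, b, c, ← e, neg_eq_iff_eq_neg.1 f.symm, d]
  noncomm_ring

lemma solvesNormalizedRHP_of_singularIntegral (hv : MemLinfty v)
    (h2 : MemLp (fun z => v z - 1) 2) {h : L2M}
    (hh : (hardyPlus M2 + mulRight hv ∘L hardyMinus M2) h = h2.toLp) :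
    SolvesNormalizedRHP v (fun z => 1 + hardyPlus M2 h z) (fun z => 1 - hardyMinus M2 h z) := by
  have hp := isCauchyPlus_hardyPlus (Lp.memLp h)
  have hm := isCauchyMinus_hardyMinus (Lp.memLp h)
  rw [Lp.toLp_coeFn] at hp hm
  refine ⟨⟨?_, ?_, h, Lp.memLp h, ?_, ?_⟩, ?_⟩
  · simpa using Lp.memLp (hardyPlus M2 h)
  · simp only [sub_sub_cancel_left]
    exact (Lp.memLp (hardyMinus M2 h)).neg
  · simpa using hp
  · simpa using hm
  · change hardyPlus M2 h + mulRight hv (hardyMinus M2 h) = _ at hh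
    have e := Lp.coeFn_add (hardyPlus M2 h) (mulRight hv (hardyMinus M2 h))
    rw [hh] at e
    filter_upwards [e, coeFn_mulRight hv (hardyMinus M2 h), h2.coeFn_toLp] with z a b c
    rw [c, Pi.add_apply, b] at a
    rw [sub_mul, one_mul, eq_sub_iff_add_eq, add_assoc, ← a]
    abel

lemma IsAlmostCoercive.existsUnique_solution (hc : IsAlmostCoercive v v₀)
    (h2 : MemLp (fun z => v z - 1) 2) :
    ∃ mp mm : ℝ → M2, SolvesNormalizedRHP v mp mm ∧
      ∀ mp' mm' : ℝ → M2, SolvesNormalizedRHP v mp' mm' →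
        mp' =ᵐ[volume] mp ∧ mm' =ᵐ[volume] mm := by
  obtain ⟨hi, hs⟩ := hc.bijective_add_mulRight_hardyMinus
  obtain ⟨h, hh⟩ := hs h2.toLp
  refine ⟨_, _, solvesNormalizedRHP_of_singularIntegral hc.memLinfty h2 hh, ?_⟩
  rintro mp' mm' ⟨⟨-, -, g, hg, hp, hm⟩, hjump⟩
  -- The density of any other solution satisfies the same singular integral equation, and the
  -- density determines both boundary values.
  have hgh : hg.toLp = h :=
    hi ((singularIntegral_of_solves hc.memLinfty h2 hg hp hm hjump).trans hh.symm)
  have hp' := hp.ae_eq (isCauchyPlus_hardyPlus hg)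
  have hm' := hm.ae_eq (isCauchyMinus_hardyMinus hg)
  rw [hgh] at hp' hm'
  constructor
  · filter_upwards [hp'] with z hz
    rw [← hz, add_sub_cancel]
  · filter_upwards [hm'] with z hz
    rw [sub_eq_add_neg, ← hz, add_sub_cancel]

end NormalizedProblem

end KdVRHP

end

open KdVRHP
theorem mainTheorem10 (r : ℝ → ℂ) (hcont : Continuous r)
    (hlt : ∀ z : ℝ, z ≠ 0 → ‖r z‖ < 1) (hzero : ‖r 0‖ = 1)
    (hinfty : Tendsto r (cocompact ℝ) (𝓝 0)) (x t : ℝ) :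
    (∀ vm vp : ℝ → M2, IsFactorization (kdvJump r x t) vm vp →
      ∃ Cω : L2M →L[ℂ] L2M,
        IsBasicOperator (fun z => 1 - vm z) (fun z => vp z - 1) Cω ∧
        (ContinuousLinearMap.id ℂ L2M - Cω).IsFredholm ∧
        fredholmIndex (ContinuousLinearMap.id ℂ L2M - Cω) = 0 ∧
        (ContinuousLinearMap.id ℂ L2M - Cω).ker = ⊥ ∧
        Function.Bijective (ContinuousLinearMap.id ℂ L2M - Cω)) ∧
    (MemLp r 2 →
      ∃ mp mm : ℝ → M2, SolvesNormalizedRHP (kdvJump r x t) mp mm ∧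
        ∀ mp' mm' : ℝ → M2, SolvesNormalizedRHP (kdvJump r x t) mp' mm' →
          mp' =ᵐ[volume] mp ∧ mm' =ᵐ[volume] mm) := by
  have hr : ∀ z, ‖r z‖ ≤ 1 := fun z => by
    rcases eq_or_ne z 0 with rfl | hz
    · exact hzero.le
    · exact (hlt z hz).le
  have hc := isAlmostCoercive_kdvJump (x := x) (t := t) hcont hlt hr hinfty
  refine ⟨fun vm vp hf => ?_, fun h2 =>
    hc.existsUnique_solution (memLp_kdvJump_sub_one hcont hr h2)⟩
  have hb := hc.id_sub_basicOperator_bijective hf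
  exact ⟨basicOperator hf, isBasicOperator_basicOperator hf, isFredholm_of_bijective hb,
    fredholmIndex_eq_zero_of_bijective hb, LinearMap.ker_eq_bot.2 hb.1, hb⟩
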